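/- Let $\mathfrak A$ be an AF $\mathrm C^*$-algebra with a sequence $\mathfrak A_0\subseteq\mathfrak A_1\subseteq\cdots$ of finite-dimensional $\mathrm C^*$-subalgebras with dense union, each $\mathfrak A_n=\bigoplus_r M_{k(n,r)}(\mathbb C)$ equipped with matrix units $e^{(n,r)}_{ij}$ such that every matrix unit of $\mathfrak A_n$ is a sum of matrix units of $\mathfrak A_{n+1}$. Let $\mathcal A\subseteq\mathfrak A$ be a strongly maximal TAF algebra, that is, a norm-closed subalgebra such that, for a suitable such system, $\mathcal A\cap\mathcal A^*$ is the closed span of the diagonal matrix units $e^{(n,r)}_{ii}$, the union of the algebras $\mathcal A\cap\mathfrak A_n$ is dense in $\mathcal A$, and each $\mathcal A\cap\mathfrak A_n$ is the direct sum of the full upper triangular matrix algebras $\operatorname{span}\{e^{(n,r)}_{ij}: i\le j\}$. (Neither $\mathfrak A$ nor $\mathcal A$ is assumed to be unital.) A bounded nest representation of $\mathcal A$ is a bounded algebra homomorphism $\pi:\mathcal A\to\mathcal B(\mathcal H)$, $\mathcal H$ a complex Hilbert space, such that the closed subspaces of $\mathcal H$ invariant under $\pi(\mathcal A)$ are totally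 ordered by inclusion. A closed two-sided ideal $\mathcal J$ of $\mathcal A$ is meet-irreducible if, for all closed two-sided ideals $\mathcal I_1,\mathcal I_2$ of $\mathcal A$ containing $\mathcal J$, $\mathcal I_1\cap\mathcal I_2=\mathcal J$ implies $\mathcal I_1=\mathcal J$ or $\mathcal I_2=\mathcal J$. An ideal is n-primitive if it is the kernel of a bounded nest representation of $\mathcal A$. (1) If $\pi$ is a bounded nest representation of $\mathcal A$ on a Hilbert space, then $\ker\pi$ is a meet-irreducible (closed, two-sided) ideal of $\mathcal A$. (2) Consequently, a two-sided ideal of $\mathcal A$ is n-primitive if and only if it is meet-irreducible. -/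

import Mathlib

/-- A sequence of finite-dimensional C*-subalgebras `𝔄₀ ⊆ 𝔄₁ ⊆ ⋯` with dense union in `𝔄`,
given by compatible matrix units: `𝔄ₙ` is the direct sum over `r : Fin (blocks n)` of the full
matrix algebras of size `size n r`, with matrix units `e n r i j`, and every matrix unit of `𝔄ₙ`
is a sum of matrix units of `𝔄ₙ₊₁`. -/
structure AFSystem (𝔄 : Type*) [NonUnitalCStarAlgebra 𝔄] where
  blocks : ℕ → ℕ
  size : (n : ℕ) → Fin (blocks n) → ℕ
  e : (n : ℕ) → (r : Fin (blocks n)) → Fin (size n r) → Fin (size n r) → 𝔄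
  e_ne_zero : ∀ n r i j, e n r i j ≠ 0
  star_e : ∀ n r i j, star (e n r i j) = e n r j i
  e_mul_e : ∀ n r i j k l, e n r i j * e n r k l = if j = k then e n r i l else 0
  e_mul_e_of_ne : ∀ n r r' i j k l, r ≠ r' → e n r i j * e n r' k l = 0
  refine_e : ∀ n r i j,
    ∃ s : Finset (Σ t : Fin (blocks (n + 1)), Fin (size (n + 1) t) × Fin (size (n + 1) t)),
      e n r i j = ∑ x ∈ s, e (n + 1) x.1 x.2.1 x.2.2
  dense_span : Dense (Submodule.span ℂ {x : 𝔄 | ∃ n r i j, x = e n r i j} : Set 𝔄)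

namespace AFSystem

variable {𝔄 : Type*} [NonUnitalCStarAlgebra 𝔄] (M : AFSystem 𝔄)

/-- The finite-dimensional C*-algebra `𝔄ₙ`. -/
def level (n : ℕ) : Submodule ℂ 𝔄 :=
  Submodule.span ℂ {x | ∃ r i j, x = M.e n r i j}

/-- The direct sum of the full upper triangular matrix algebras of the summands of `𝔄ₙ`. -/
def upper (n : ℕ) : Submodule ℂ 𝔄 :=
  Submodule.span ℂ {x | ∃ r i j, i ≤ j ∧ x = M.e n r i j}

/-- The canonical masa of the system: the closed span of all diagonal matrix units. -/
def masa : Submodule ℂ 𝔄 :=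
  (Submodule.span ℂ {x | ∃ n r i, x = M.e n r i i}).topologicalClosure

end AFSystem

section TAF

variable {𝔄 : Type*} [NonUnitalCStarAlgebra 𝔄]

/-- `A` is a triangular AF algebra with respect to the system `M`: a closed subalgebra whose
diagonal `A ∩ A*` is the canonical masa and which is the limit of the algebras `A ∩ 𝔄ₙ`. -/
structure IsTAF (M : AFSystem 𝔄) (A : NonUnitalSubalgebra ℂ 𝔄) : Prop where
  isClosed : IsClosed (A : Set 𝔄)
  diagonal : ∀ a : 𝔄, (a ∈ A ∧ star a ∈ A) ↔ a ∈ M.masa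
  limit : (A : Set 𝔄) ⊆ closure (⋃ n, (A : Set 𝔄) ∩ M.level n)

/-- `A` is strongly maximal: it is triangular AF for some system for which every `A ∩ 𝔄ₙ` is
maximal triangular in `𝔄ₙ`, that is, the direct sum of the full upper triangular algebras. -/
def IsStronglyMaximalTAF (A : NonUnitalSubalgebra ℂ 𝔄) : Prop :=
  ∃ M : AFSystem 𝔄, IsTAF M A ∧ ∀ n, A.toSubmodule ⊓ M.level n = M.upper n

variable {A : NonUnitalSubalgebra ℂ 𝔄}

/-- A closed two-sided ideal `J` is meet irreducible if it is not the intersection of two closed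
two-sided ideals that both contain it properly. -/
def IsMeetIrreducible (J : TwoSidedIdeal A) : Prop :=
  IsClosed (J : Set A) ∧
    ∀ I₁ I₂ : TwoSidedIdeal A, IsClosed (I₁ : Set A) → IsClosed (I₂ : Set A) →
      J ≤ I₁ → J ≤ I₂ → I₁ ⊓ I₂ = J → I₁ = J ∨ I₂ = J

/-- A bounded nest representation: a bounded homomorphism into the bounded operators of a Hilbert
space whose closed invariant subspaces are totally ordered by inclusion. -/
structure IsBoundedNestRep {H : Type*} [NormedAddCommGroup H] [InnerProductSpace ℂ H]
    (π : A →ₙₐ[ℂ] (H →L[ℂ] H)) : Prop where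
  bounded : ∃ C : ℝ, ∀ a : A, ‖π a‖ ≤ C * ‖(a : 𝔄)‖
  nest : ∀ K L : Submodule ℂ H, IsClosed (K : Set H) → IsClosed (L : Set H) →
    (∀ a : A, ∀ h ∈ K, π a h ∈ K) → (∀ a : A, ∀ h ∈ L, π a h ∈ L) → K ≤ L ∨ L ≤ K

/-- An ideal is n-primitive if it is the kernel of a bounded nest representation on a Hilbert
space (in the universe `v`). -/
def IsNPrimitive.{v, u} {𝔄 : Type u} [NonUnitalCStarAlgebra 𝔄] {A : NonUnitalSubalgebra ℂ 𝔄}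
    (J : TwoSidedIdeal A) : Prop :=
  ∃ (H : Type v) (_ : NormedAddCommGroup H) (_ : InnerProductSpace ℂ H) (_ : CompleteSpace H)
    (π : A →ₙₐ[ℂ] (H →L[ℂ] H)), IsBoundedNestRep π ∧ TwoSidedIdeal.ker π = J

end TAF

universe u v

/-! Everything rests on one fact: a closed ideal of `A` is the closed span of the matrix units it
contains (`le_closure_unitSpan`), so closed ideals can be compared on matrix units (`le_of_e_mem`).

Part (1). Let `J = ker π` and `I₁ ⊓ I₂ = J`. The vectors annihilated by `I₁` and those annihilated
by `I₂` form closed invariant subspaces `N₁`, `N₂`, so one contains the other, say `N₁ ≤ N₂`. Upper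
triangularity makes the units of an ideal in a given column an initial segment of that column. Hence
in every column of `𝔄ₘ` one of the two ideals has no unit outside `J` (`column_dichotomy`). Let `uₘ`
be the sum of the diagonal units at the columns where `I₁` has none. Then `π (a * uₘ)` is `0` for `a
∈ I₁` and `π a` for `a ∈ I₂`, once `a` lies in `𝔄ₘ`. A weak limit `z` of `π uₘ h` is killed by `I₁`,
so it lies in `N₁ ≤ N₂`; hence `π a h = π a z = 0` on `I₂`, first for matrix units and then for all
elements. Thus `I₂ ≤ J`.

Part (2), the converse. Let `J` be proper and meet irreducible. Intersecting the ideals generated by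
`J` and each of two units outside `J` yields a deeper unit outside `J` lying in both ideals
generated by the single units (`exists_common_unit`). As there are countably many units, there is a
sequence of units outside `J`, each embedded in the next, that eventually falls into the ideal
generated by any given unit outside `J` (`exists_cell_seq`). Marking a diagonal position between row
and column of each gives decreasing projections, and a GNS construction gives a unit vector `ξ`
fixed by all of them. Applying to `ξ` the units of the marked columns, with rows in the intervals,
gives an orthonormal set. Elements of `A` only move positions upwards, so a path that starts and
ends in an interval never leaves it. Compression to the closed span of this set is therefore
multiplicative on `A` (`compressCLM_mul`). Its kernel is `J` (`compressCLM_eq_zero_iff`). Diagonal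
units recover the coordinate projections in the strong limit, so closed invariant subspaces are
spanned by basis vectors, and the units of `A` put these in a linear order
(`isBoundedNestRep_compressHom`). -/

namespace AFSystem

/-! ### Matrix unit calculus inside one `𝔄ₙ`. -/

variable {𝔄 : Type*} [NonUnitalCStarAlgebra 𝔄] (M : AFSystem 𝔄)

/-- The index set of the diagonal matrix units of `𝔄ₙ`. -/
abbrev Idx (n : ℕ) := Σ r : Fin (M.blocks n), Fin (M.size n r)

/-- The diagonal matrix units of `𝔄ₙ`. -/
def p (n : ℕ) (x : M.Idx n) : 𝔄 := M.e n x.1 x.2 x.2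

/-- The identity of `𝔄ₙ`. -/
def one (n : ℕ) : 𝔄 := ∑ x : M.Idx n, M.p n x

variable {M}

theorem star_p (n : ℕ) (x : M.Idx n) : star (M.p n x) = M.p n x := M.star_e n x.1 x.2 x.2

theorem p_ne_zero (n : ℕ) (x : M.Idx n) : M.p n x ≠ 0 := M.e_ne_zero n x.1 x.2 x.2

theorem p_mul_self (n : ℕ) (x : M.Idx n) : M.p n x * M.p n x = M.p n x := by
  simp [p, M.e_mul_e]

theorem p_mul_e (n : ℕ) (x : M.Idx n) (r : Fin (M.blocks n)) (i j : Fin (M.size n r)) :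
    M.p n x * M.e n r i j = if x = ⟨r, i⟩ then M.e n r i j else 0 := by
  obtain ⟨t, k⟩ := x
  by_cases h : t = r
  · subst h
    simp only [p, M.e_mul_e, Sigma.mk.injEq, heq_eq_eq, true_and]
    split_ifs with hk
    · rw [hk]
    · rfl
  · rw [if_neg (by rintro ⟨⟩; exact h rfl)]
    exact M.e_mul_e_of_ne _ _ _ _ _ _ _ h

theorem e_mul_p (n : ℕ) (x : M.Idx n) (r : Fin (M.blocks n)) (i j : Fin (M.size n r)) :
    M.e n r i j * M.p n x = if x = ⟨r, j⟩ then M.e n r i j else 0 := by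
  have := congrArg star (p_mul_e n x r j i)
  rw [star_mul, star_p, M.star_e] at this
  rw [this]
  split_ifs <;> simp [M.star_e]

theorem p_mul_p (n : ℕ) (x y : M.Idx n) :
    M.p n x * M.p n y = if x = y then M.p n y else 0 :=
  p_mul_e n x y.1 y.2 y.2

theorem p_mul_p_of_ne {n : ℕ} {x y : M.Idx n} (h : x ≠ y) : M.p n x * M.p n y = 0 := by
  rw [p_mul_p, if_neg h]

theorem e_mem_level (n : ℕ) (r : Fin (M.blocks n)) (i j : Fin (M.size n r)) :
    M.e n r i j ∈ M.level n := Submodule.subset_span ⟨r, i, j, rfl⟩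

theorem p_mem_level (n : ℕ) (x : M.Idx n) : M.p n x ∈ M.level n := e_mem_level _ _ _ _

theorem star_one (n : ℕ) : star (M.one n) = M.one n := by simp [one, star_p]

theorem one_mul_e (n : ℕ) (r : Fin (M.blocks n)) (i j : Fin (M.size n r)) :
    M.one n * M.e n r i j = M.e n r i j := by
  simp [one, Finset.sum_mul, p_mul_e]

theorem one_mul_of_mem {n : ℕ} {a : 𝔄} (ha : a ∈ M.level n) : M.one n * a = a := by
  induction ha using Submodule.span_induction with
  | mem x h => obtain ⟨r, i, j, rfl⟩ := h; exact one_mul_e _ _ _ _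
  | zero => simp
  | add x y _ _ hx hy => rw [mul_add, hx, hy]
  | smul c x _ hx => rw [mul_smul_comm, hx]

theorem star_mem_level {n : ℕ} {a : 𝔄} (ha : a ∈ M.level n) : star a ∈ M.level n := by
  induction ha using Submodule.span_induction with
  | mem x h => obtain ⟨r, i, j, rfl⟩ := h; rw [M.star_e]; exact e_mem_level _ _ _ _
  | zero => simp
  | add x y _ _ hx hy => rw [star_add]; exact add_mem hx hy
  | smul c x _ hx => rw [star_smul]; exact Submodule.smul_mem _ _ hx

theorem mul_one_of_mem {n : ℕ} {a : 𝔄} (ha : a ∈ M.level n) : a * M.one n = a := by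
  have := congrArg star (one_mul_of_mem (star_mem_level ha))
  simpa [star_one] using this

theorem mul_mem_level {n : ℕ} {a b : 𝔄} (ha : a ∈ M.level n) (hb : b ∈ M.level n) :
    a * b ∈ M.level n := by
  induction ha using Submodule.span_induction with
  | mem x h =>
    obtain ⟨r, i, j, rfl⟩ := h
    induction hb using Submodule.span_induction with
    | mem x h =>
      obtain ⟨t, k, l, rfl⟩ := h
      by_cases h : r = t
      · subst h
        rw [M.e_mul_e]
        split_ifs
        · exact e_mem_level _ _ _ _
        · exact zero_mem _
      · rw [M.e_mul_e_of_ne _ _ _ _ _ _ _ h]; exact zero_mem _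
    | zero => simp
    | add x y _ _ hx hy => rw [mul_add]; exact add_mem hx hy
    | smul c x _ hx => rw [mul_smul_comm]; exact Submodule.smul_mem _ _ hx
  | zero => simp
  | add x y _ _ hx hy => rw [add_mul]; exact add_mem hx hy
  | smul c x _ hx => rw [smul_mul_assoc]; exact Submodule.smul_mem _ _ hx

theorem level_mono : Monotone M.level := by
  refine monotone_nat_of_le_succ fun n => Submodule.span_le.2 ?_
  rintro _ ⟨r, i, j, rfl⟩
  obtain ⟨s, hs⟩ := M.refine_e n r i j
  rw [hs]
  exact Submodule.sum_mem _ fun x _ => e_mem_level _ _ _ _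

/-- Compressing an element of `𝔄ₙ` by two diagonal matrix units of one summand. -/
theorem exists_corner {n : ℕ} {a : 𝔄} (ha : a ∈ M.level n) (r : Fin (M.blocks n))
    (i j : Fin (M.size n r)) :
    ∃ c : ℂ, M.e n r i i * a * M.e n r j j = c • M.e n r i j := by
  induction ha using Submodule.span_induction with
  | mem x h =>
    obtain ⟨t, k, l, rfl⟩ := h
    by_cases h : r = t
    · subst h
      by_cases hk : i = k
      · subst hk
        by_cases hl : l = j
        · subst hl; exact ⟨1, by simp [M.e_mul_e]⟩
        · exact ⟨0, by simp [M.e_mul_e, hl]⟩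
      · exact ⟨0, by simp [M.e_mul_e, hk]⟩
    · exact ⟨0, by simp [M.e_mul_e_of_ne _ _ _ _ _ _ _ h]⟩
  | zero => exact ⟨0, by simp⟩
  | add x y _ _ hx hy =>
    obtain ⟨c, hc⟩ := hx
    obtain ⟨d, hd⟩ := hy
    exact ⟨c + d, by rw [mul_add, add_mul, hc, hd, add_smul]⟩
  | smul c x _ hx =>
    obtain ⟨d, hd⟩ := hx
    exact ⟨c * d, by rw [mul_smul_comm, smul_mul_assoc, hd, smul_smul]⟩

theorem corner_of_ne {n : ℕ} {a : 𝔄} (ha : a ∈ M.level n) {x y : M.Idx n} (hxy : x.1 ≠ y.1) :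
    M.p n x * a * M.p n y = 0 := by
  induction ha using Submodule.span_induction with
  | mem z h =>
    obtain ⟨t, k, l, rfl⟩ := h
    rw [p_mul_e]
    split_ifs with h
    · rw [e_mul_p, if_neg]
      rintro rfl
      exact hxy (by rw [h])
    · simp
  | zero => simp
  | add x y _ _ hx hy => rw [mul_add, add_mul, hx, hy, add_zero]
  | smul c x _ hx => rw [mul_smul_comm, smul_mul_assoc, hx, smul_zero]

theorem corner_upper {n : ℕ} {a : 𝔄} (ha : a ∈ M.upper n) {r : Fin (M.blocks n)}
    {i j : Fin (M.size n r)} (hij : j < i) : M.e n r i i * a * M.e n r j j = 0 := by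
  induction ha using Submodule.span_induction with
  | mem x h =>
    obtain ⟨t, k, l, hkl, rfl⟩ := h
    by_cases h : r = t
    · subst h
      rw [M.e_mul_e]
      split_ifs with h1
      · rw [M.e_mul_e, if_neg]
        rintro rfl
        exact absurd (h1 ▸ hkl) (not_le.2 hij)
      · simp
    · simp [M.e_mul_e_of_ne _ _ _ _ _ _ _ h]
  | zero => simp
  | add x y _ _ hx hy => rw [mul_add, add_mul, hx, hy, add_zero]
  | smul c x _ hx => rw [mul_smul_comm, smul_mul_assoc, hx, smul_zero]

theorem le_of_mem_upper {n : ℕ} {r : Fin (M.blocks n)} {i j : Fin (M.size n r)}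
    (h : M.e n r i j ∈ M.upper n) : i ≤ j := by
  by_contra hij
  have := corner_upper h (not_le.1 hij)
  simp only [M.e_mul_e, if_true] at this
  exact M.e_ne_zero _ _ _ _ this

/-- Expansion of an element of `𝔄ₙ` along the diagonal matrix units. -/
theorem eq_sum_corner {n : ℕ} {a : 𝔄} (ha : a ∈ M.level n) :
    a = ∑ x : M.Idx n, ∑ y : M.Idx n, M.p n x * a * M.p n y := by
  conv_lhs => rw [← mul_one_of_mem ha, ← one_mul_of_mem ha]
  simp only [one, Finset.sum_mul, Finset.mul_sum]
  exact Finset.sum_comm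

theorem norm_e (n : ℕ) (r : Fin (M.blocks n)) (i j : Fin (M.size n r)) : ‖M.e n r i j‖ = 1 := by
  have key : ∀ k, ‖M.e n r k k‖ = 1 := fun k => by
    have h := CStarRing.norm_star_mul_self (x := M.e n r k k)
    rw [M.star_e, M.e_mul_e, if_pos rfl] at h
    have h0 : ‖M.e n r k k‖ ≠ 0 := norm_ne_zero_iff.2 (M.e_ne_zero _ _ _ _)
    field_simp at h
    exact h.symm
  have h := CStarRing.norm_star_mul_self (x := M.e n r i j)
  rw [M.star_e, M.e_mul_e, if_pos rfl, key] at h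
  nlinarith [norm_nonneg (M.e n r i j)]

end AFSystem

/-! ### Norm estimates for pinchings and combinations of orthogonal projections. -/

/-- `1 - 2p` is a unitary of the unitization; the identity is written out because `𝔄` may lack a
unit. -/
theorem norm_sub_two_mul {𝔄 : Type*} [NonUnitalCStarAlgebra 𝔄] {p : 𝔄} (hs : star p = p)
    (hp : p * p = p) (b : 𝔄) : ‖b - (2 : ℂ) • (p * b)‖ = ‖b‖ := by
  have h : star (b - (2 : ℂ) • (p * b)) * (b - (2 : ℂ) • (p * b)) = star b * b := by
    have h1 : p * (p * b) = p * b := by rw [← mul_assoc, hp]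
    simp only [star_sub, star_smul, star_mul, hs, sub_mul, mul_sub, smul_mul_assoc, mul_smul_comm,
      mul_assoc, h1, star_ofNat]
    module
  have h2 := CStarRing.norm_star_mul_self (x := b - (2 : ℂ) • (p * b))
  rw [h, CStarRing.norm_star_mul_self] at h2
  exact ((mul_self_inj (norm_nonneg _) (norm_nonneg _)).1 h2).symm

theorem norm_sub_two_mul' {𝔄 : Type*} [NonUnitalCStarAlgebra 𝔄] {p : 𝔄} (hs : star p = p)
    (hp : p * p = p) (b : 𝔄) : ‖b - (2 : ℂ) • (b * p)‖ = ‖b‖ := by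
  have := norm_sub_two_mul hs hp (star b)
  rw [norm_star] at this
  rw [← this, ← norm_star (b - _)]
  simp [hs]

/-- The element is `p a p + (1 - p) a (1 - p)`, the average of `a` and its conjugate by the symmetry
`1 - 2p`. -/
theorem norm_pinch_one_le {𝔄 : Type*} [NonUnitalCStarAlgebra 𝔄] {p : 𝔄} (hs : star p = p)
    (hp : p * p = p) (a : 𝔄) : ‖a - p * a - a * p + (2 : ℂ) • (p * a * p)‖ ≤ ‖a‖ := by
  have h : a - p * a - a * p + (2 : ℂ) • (p * a * p) = (2⁻¹ : ℂ) • (a +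
      ((a - (2 : ℂ) • (p * a)) - (2 : ℂ) • ((a - (2 : ℂ) • (p * a)) * p))) := by
    simp only [sub_mul, smul_mul_assoc]
    module
  rw [h, norm_smul]
  have h1 := norm_add_le a ((a - (2 : ℂ) • (p * a)) - (2 : ℂ) • ((a - (2 : ℂ) • (p * a)) * p))
  rw [norm_sub_two_mul' hs hp, norm_sub_two_mul hs hp] at h1
  norm_num
  linarith

/-- Keeping the complementary corner `(1 - P) a (1 - P)` makes the induction close: adding a
projection is one more two-block pinching of the element already pinched. -/
theorem norm_sum_pinch_add_le {𝔄 : Type*} [NonUnitalCStarAlgebra 𝔄] {ι : Type*}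
    (s : Finset ι) (p : ι → 𝔄) (hs : ∀ k ∈ s, star (p k) = p k)
    (hp : ∀ k ∈ s, p k * p k = p k) (ho : ∀ k ∈ s, ∀ l ∈ s, k ≠ l → p k * p l = 0) (a : 𝔄) :
    ‖∑ k ∈ s, p k * a * p k + (a - (∑ k ∈ s, p k) * a - a * (∑ k ∈ s, p k) +
      (∑ k ∈ s, p k) * a * (∑ k ∈ s, p k))‖ ≤ ‖a‖ := by
  classical
  induction s using Finset.induction_on with
  | empty => simp
  | insert j s hj ih =>
    have ih := ih (fun k hk => hs k (Finset.mem_insert_of_mem hk))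
      (fun k hk => hp k (Finset.mem_insert_of_mem hk))
      (fun k hk l hl => ho k (Finset.mem_insert_of_mem hk) l (Finset.mem_insert_of_mem hl))
    have hjs : ∀ k ∈ s, p j * p k = 0 := fun k hk =>
      ho j (Finset.mem_insert_self _ _) k (Finset.mem_insert_of_mem hk) (by rintro rfl; exact hj hk)
    have hsj : ∀ k ∈ s, p k * p j = 0 := fun k hk =>
      ho k (Finset.mem_insert_of_mem hk) j (Finset.mem_insert_self _ _) (by rintro rfl; exact hj hk)
    have h1 : p j * ∑ k ∈ s, p k = 0 := by
      rw [Finset.mul_sum]; exact Finset.sum_eq_zero hjs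
    have h2 : (∑ k ∈ s, p k) * p j = 0 := by
      rw [Finset.sum_mul]; exact Finset.sum_eq_zero hsj
    have h3 : p j * ∑ k ∈ s, p k * a * p k = 0 := by
      rw [Finset.mul_sum]
      exact Finset.sum_eq_zero fun k hk => by rw [← mul_assoc, ← mul_assoc, hjs k hk]; simp
    have h4 : (∑ k ∈ s, p k * a * p k) * p j = 0 := by
      rw [Finset.sum_mul]
      exact Finset.sum_eq_zero fun k hk => by rw [mul_assoc, hsj k hk]; simp
    refine le_trans (le_of_eq ?_) ((norm_pinch_one_le (hs j (Finset.mem_insert_self _ _))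
      (hp j (Finset.mem_insert_self _ _)) _).trans ih)
    congr 1
    rw [Finset.sum_insert hj, Finset.sum_insert hj]
    generalize (∑ k ∈ s, p k) = P at *
    generalize (∑ k ∈ s, p k * a * p k) = S at *
    have h5 : ∀ b, p j * (P * b) = 0 := fun b => by rw [← mul_assoc, h1, zero_mul]
    simp only [mul_add, add_mul, mul_sub, sub_mul, mul_assoc, h2, h3, h4, h5, mul_zero, zero_mul]
    module

/-- Pinching by finitely many orthogonal projections is contractive. -/
theorem norm_sum_pinch_le {𝔄 : Type*} [NonUnitalCStarAlgebra 𝔄] {ι : Type*}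
    (s : Finset ι) (p : ι → 𝔄) (hs : ∀ k ∈ s, star (p k) = p k)
    (hp : ∀ k ∈ s, p k * p k = p k) (ho : ∀ k ∈ s, ∀ l ∈ s, k ≠ l → p k * p l = 0) (a : 𝔄) :
    ‖∑ k ∈ s, p k * a * p k‖ ≤ ‖a‖ := by
  classical
  set P := ∑ k ∈ s, p k with hP
  have hPs : star P = P := by
    rw [hP, star_sum]; exact Finset.sum_congr rfl hs
  have h1 : ∀ k ∈ s, P * p k = p k := fun k hk => by
    rw [hP, Finset.sum_mul, Finset.sum_eq_single k, hp k hk]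
    · exact fun l hl hlk => ho l hl k hk hlk
    · exact fun h => absurd hk h
  have h2 : ∀ k ∈ s, p k * P = p k := fun k hk => by
    rw [hP, Finset.mul_sum, Finset.sum_eq_single k, hp k hk]
    · exact fun l hl hlk => ho k hk l hl hlk.symm
    · exact fun h => absurd hk h
  have hPP : P * P = P := by
    conv_lhs => rw [hP, Finset.sum_mul]
    exact Finset.sum_congr rfl h2
  have hPn : ‖P‖ ≤ 1 := IsStarProjection.norm_le P ⟨hPP, hPs⟩
  -- Compression by `P` removes the complementary corner.
  have h3 : ∑ k ∈ s, p k * a * p k = P * (∑ k ∈ s, p k * a * p k + (a - P * a - a * P +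
      P * a * P)) * P := by
    have h4 : P * (a - P * a - a * P + P * a * P) * P = 0 := by
      have : ∀ b, P * (P * b) = P * b := fun b => by rw [← mul_assoc, hPP]
      simp only [mul_add, add_mul, mul_sub, sub_mul, mul_assoc, this, hPP]
      abel
    rw [mul_add, add_mul, h4, add_zero, Finset.mul_sum _ _ P, Finset.sum_mul]
    refine Finset.sum_congr rfl fun k hk => ?_
    rw [← mul_assoc P, ← mul_assoc P, h1 k hk, mul_assoc _ (p k) P, h2 k hk]
  rw [h3]
  calc _ ≤ ‖P‖ * ‖_‖ * ‖P‖ := (norm_mul_le _ _).trans (by gcongr; exact norm_mul_le _ _)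
    _ ≤ 1 * ‖a‖ * 1 := by
      gcongr
      exact norm_sum_pinch_add_le s p hs hp ho a
    _ = ‖a‖ := by ring

/-- A finite combination of orthogonal projections is bounded by its largest coefficient. -/
theorem norm_sum_smul_le {𝔄 : Type*} [NonUnitalCStarAlgebra 𝔄] {ι : Type*}
    (s : Finset ι) (p : ι → 𝔄) (hs : ∀ k ∈ s, star (p k) = p k)
    (hp : ∀ k ∈ s, p k * p k = p k) (ho : ∀ k ∈ s, ∀ l ∈ s, k ≠ l → p k * p l = 0)
    (c : ι → ℂ) {C : ℝ} (hC : 0 ≤ C) (hc : ∀ k ∈ s, ‖c k‖ ≤ C) :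
    ‖∑ k ∈ s, c k • p k‖ ≤ C := by
  classical
  let _ := CStarAlgebra.spectralOrder 𝔄
  let _ := CStarAlgebra.spectralOrderedRing 𝔄
  have hnn : ∀ k ∈ s, 0 ≤ p k := fun k hk => by
    have := star_mul_self_nonneg (p k)
    rwa [hs k hk, hp k hk] at this
  have hmul : ∀ d d' : ι → ℂ, (∑ k ∈ s, d k • p k) * (∑ k ∈ s, d' k • p k) =
      ∑ k ∈ s, (d k * d' k) • p k := fun d d' => by
    rw [Finset.sum_mul]
    refine Finset.sum_congr rfl fun k hk => ?_
    rw [Finset.mul_sum, Finset.sum_eq_single k]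
    · rw [smul_mul_smul_comm, hp k hk]
    · intro l hl hlk
      rw [smul_mul_smul_comm, ho k hk l hl hlk.symm, smul_zero]
    · exact fun h => absurd hk h
  have hstar : star (∑ k ∈ s, c k • p k) = ∑ k ∈ s, (star (c k)) • p k := by
    rw [star_sum]
    exact Finset.sum_congr rfl fun k hk => by rw [star_smul, hs k hk]
  have h1 : star (∑ k ∈ s, c k • p k) * (∑ k ∈ s, c k • p k) =
      ∑ k ∈ s, (‖c k‖ ^ 2 : ℝ) • p k := by
    rw [hstar, hmul]
    refine Finset.sum_congr rfl fun k _ => ?_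
    have : star (c k) * c k = ((‖c k‖ ^ 2 : ℝ) : ℂ) := by
      rw [Complex.star_def, Complex.conj_mul']; push_cast; rfl
    rw [this, Complex.coe_smul]
  have hPn : ‖∑ k ∈ s, p k‖ ≤ 1 := by
    refine IsStarProjection.norm_le _ ⟨?_, ?_⟩
    · have := hmul (fun _ => 1) (fun _ => 1)
      simpa [IsIdempotentElem] using this
    · change star _ = _
      rw [star_sum]
      exact Finset.sum_congr rfl hs
  -- `star x * x` is positive and at most `C²` times a projection, and the norm is monotone on
  -- positive elements.
  have h2 : ‖∑ k ∈ s, (‖c k‖ ^ 2 : ℝ) • p k‖ ≤ ‖(C ^ 2) • ∑ k ∈ s, p k‖ := by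
    refine CStarAlgebra.norm_le_norm_of_nonneg_of_le ?_ ?_
    · exact Finset.sum_nonneg fun k hk => smul_nonneg (by positivity) (hnn k hk)
    · rw [Finset.smul_sum]
      exact Finset.sum_le_sum fun k hk =>
        smul_le_smul_of_nonneg_right (pow_le_pow_left₀ (norm_nonneg _) (hc k hk) 2) (hnn k hk)
  rw [norm_smul] at h2
  have h3 := CStarRing.norm_star_mul_self (x := ∑ k ∈ s, c k • p k)
  rw [h1] at h3
  rw [h3] at h2
  have h4 : ‖C ^ 2‖ = C ^ 2 := by simp
  rw [h4] at h2
  refine abs_le_of_sq_le_sq' ?_ hC |>.2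
  nlinarith [sq_nonneg C]

/-! ### How matrix units of one level sit in deeper levels. -/

namespace AFSystem

variable {𝔄 : Type*} [NonUnitalCStarAlgebra 𝔄] {M : AFSystem 𝔄} {A : NonUnitalSubalgebra ℂ 𝔄}

theorem mem_upper_of_mem (hU : ∀ n, A.toSubmodule ⊓ M.level n = M.upper n) {n : ℕ} {a : 𝔄}
    (ha : a ∈ A) (hl : a ∈ M.level n) : a ∈ M.upper n := by
  rw [← hU]; exact ⟨ha, hl⟩

theorem upper_le (hU : ∀ n, A.toSubmodule ⊓ M.level n = M.upper n) (n : ℕ) :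
    M.upper n ≤ A.toSubmodule := by
  rw [← hU]; exact inf_le_left

theorem e_mem (hU : ∀ n, A.toSubmodule ⊓ M.level n = M.upper n) {n : ℕ} {r : Fin (M.blocks n)}
    {i j : Fin (M.size n r)} (hij : i ≤ j) : M.e n r i j ∈ A :=
  upper_le hU n (Submodule.subset_span ⟨r, i, j, hij, rfl⟩)

theorem e_mem_iff (hU : ∀ n, A.toSubmodule ⊓ M.level n = M.upper n) {n : ℕ} {r : Fin (M.blocks n)}
    {i j : Fin (M.size n r)} : M.e n r i j ∈ A ↔ i ≤ j :=
  ⟨fun h => le_of_mem_upper (mem_upper_of_mem hU h (e_mem_level _ _ _ _)), e_mem hU⟩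

theorem p_mem (hU : ∀ n, A.toSubmodule ⊓ M.level n = M.upper n) (n : ℕ) (x : M.Idx n) :
    M.p n x ∈ A := e_mem hU le_rfl

theorem one_mem (hU : ∀ n, A.toSubmodule ⊓ M.level n = M.upper n) (n : ℕ) : M.one n ∈ A :=
  sum_mem fun x _ => p_mem hU n x

/-- Two diagonal projections of different depth are either nested or orthogonal. -/
theorem p_mul_p_level (hU : ∀ n, A.toSubmodule ⊓ M.level n = M.upper n) {n m : ℕ} (hnm : n ≤ m)
    (x : M.Idx n) (y : M.Idx m) :
    M.p n x * M.p m y = M.p m y ∨ M.p n x * M.p m y = 0 := by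
  have hl : M.p n x ∈ M.level m := level_mono hnm (p_mem_level n x)
  have hu : M.p n x ∈ M.upper m := mem_upper_of_mem hU (p_mem hU n x) hl
  -- `M.p n x` is upper triangular in `𝔄ₘ` and self-adjoint, hence diagonal there; below, its entry
  -- at `y` is an idempotent scalar.
  have hoff : ∀ z : M.Idx m, z ≠ y → M.p m z * M.p n x * M.p m y = 0 := by
    rintro ⟨t, k⟩ hz
    obtain ⟨t', l⟩ := y
    by_cases ht : t = t'
    · subst ht
      have hkl : k ≠ l := fun h => hz (by rw [h])
      rcases lt_or_gt_of_ne hkl with h | h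
      · have := congrArg star (corner_upper hu h)
        simpa [star_p, M.star_e, p, mul_assoc] using this
      · exact corner_upper hu h
    · exact corner_of_ne hl ht
  have h1 : M.p n x * M.p m y = M.p m y * M.p n x * M.p m y := by
    conv_lhs => rw [← one_mul_of_mem hl, one, Finset.sum_mul, Finset.sum_mul]
    rw [Finset.sum_eq_single y (fun z _ hz => hoff z hz) (by simp)]
  obtain ⟨c, hc⟩ := exists_corner hl y.1 y.2 y.2
  have h2 : M.p n x * M.p m y = c • M.p m y := h1.trans hc
  have h3 : c * c = c := by
    have : M.p n x * (M.p n x * M.p m y) = M.p n x * M.p m y := by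
      rw [← mul_assoc, p_mul_self]
    rw [h2, mul_smul_comm, h2, smul_smul] at this
    exact smul_left_injective ℂ (p_ne_zero m y) this
  rcases eq_or_ne c 0 with h | h
  · right; rw [h2, h, zero_smul]
  · left
    rw [h2, mul_left_cancel₀ h (h3.trans (mul_one c).symm), one_smul]

theorem p_mul_p_comm_of_eq {n m : ℕ} {x : M.Idx n} {y : M.Idx m}
    (h : M.p n x * M.p m y = M.p m y) : M.p m y * M.p n x = M.p m y := by
  simpa [star_p] using congrArg star h

theorem p_mul_p_comm_of_eq_zero {n m : ℕ} {x : M.Idx n} {y : M.Idx m}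
    (h : M.p n x * M.p m y = 0) : M.p m y * M.p n x = 0 := by
  simpa [star_p] using congrArg star h

open Classical in
/-- A diagonal matrix unit is the sum of the deeper diagonal matrix units below it. -/
theorem p_eq_sum (hU : ∀ n, A.toSubmodule ⊓ M.level n = M.upper n) {n m : ℕ} (hnm : n ≤ m)
    (x : M.Idx n) :
    M.p n x = ∑ y : M.Idx m with M.p n x * M.p m y = M.p m y, M.p m y := by
  conv_lhs => rw [← mul_one_of_mem (level_mono hnm (p_mem_level n x)), one, Finset.mul_sum]
  rw [Finset.sum_filter]
  refine Finset.sum_congr rfl fun y _ => ?_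
  split_ifs with h
  · exact h
  · exact (p_mul_p_level hU hnm x y).resolve_left h

/-- A matrix unit of `𝔄ₙ` has entries zero and one in every deeper algebra. -/
theorem corner_e (hU : ∀ n, A.toSubmodule ⊓ M.level n = M.upper n) {n m : ℕ} (hnm : n ≤ m)
    (r : Fin (M.blocks n)) (i j : Fin (M.size n r)) (t : Fin (M.blocks m))
    (k l : Fin (M.size m t)) :
    M.e m t k k * M.e n r i j * M.e m t l l = M.e m t k l ∨
      M.e m t k k * M.e n r i j * M.e m t l l = 0 := by
  induction m, hnm using Nat.le_induction with
  | base =>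
    by_cases h : t = r
    · subst h
      simp only [M.e_mul_e]
      split_ifs with h1
      · subst h1
        rw [M.e_mul_e]
        split_ifs with h2
        · subst h2; left; rfl
        · right; rfl
      · right; simp
    · right; rw [M.e_mul_e_of_ne _ _ _ _ _ _ _ h, zero_mul]
  | succ m hnm ih =>
    have hl := level_mono hnm (e_mem_level (M := M) n r i j)
    set q := M.p (m + 1) ⟨t, k⟩ with hq
    set q' := M.p (m + 1) ⟨t, l⟩ with hq'
    change q * _ * q' = _ ∨ q * _ * q' = 0
    -- The embedding of `𝔄ₘ` need not be unital: `q` is either below one diagonal unit of level `m`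
    -- or orthogonal to the identity of `𝔄ₘ`.
    by_cases h1 : ∃ x : M.Idx m, M.p m x * q = q
    swap
    · right
      have : q * M.one m = 0 := by
        rw [one, Finset.mul_sum]
        refine Finset.sum_eq_zero fun x _ => p_mul_p_comm_of_eq_zero ?_
        exact (p_mul_p_level hU m.le_succ x _).resolve_left fun h => h1 ⟨x, h⟩
      rw [← one_mul_of_mem hl, ← mul_assoc, this]; simp
    by_cases h2 : ∃ x : M.Idx m, M.p m x * q' = q'
    swap
    · right
      have : M.one m * q' = 0 := by
        rw [one, Finset.sum_mul]
        refine Finset.sum_eq_zero fun x _ => ?_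
        exact (p_mul_p_level hU m.le_succ x _).resolve_left fun h => h2 ⟨x, h⟩
      rw [← mul_one_of_mem hl, mul_assoc, mul_assoc, this]; simp
    obtain ⟨⟨s, u⟩, hu⟩ := h1
    obtain ⟨⟨s', v⟩, hv⟩ := h2
    have h3 : q * M.e n r i j * q' =
        q * (M.p m ⟨s, u⟩ * M.e n r i j * M.p m ⟨s', v⟩) * q' := by
      have hu' : q * M.p m ⟨s, u⟩ = q := p_mul_p_comm_of_eq hu
      conv_lhs => rw [← hv, ← hu']
      simp only [mul_assoc]
    rw [h3]
    by_cases hs : s = s'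
    · subst hs
      rcases ih s u v with h | h
      · have h' : M.p m ⟨s, u⟩ * M.e n r i j * M.p m ⟨s, v⟩ = M.e m s u v := h
        rw [h']
        obtain ⟨F, hF⟩ := M.refine_e m s u v
        rw [hF, Finset.mul_sum, Finset.sum_mul]
        have h4 : ∀ x ∈ F, x ≠ ⟨t, k, l⟩ → q * M.e (m + 1) x.1 x.2.1 x.2.2 * q' = 0 := by
          rintro ⟨t', a, b⟩ _ hx
          rw [hq, p_mul_e]
          split_ifs with h5
          · rw [hq', e_mul_p, if_neg]
            intro h6
            obtain rfl : t = t' := congrArg Sigma.fst h5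
            simp only [Sigma.mk.injEq, heq_eq_eq, true_and] at h5 h6
            exact hx (by rw [h5, h6])
          · simp
        by_cases hF' : (⟨t, k, l⟩ : Σ t : Fin (M.blocks (m + 1)),
            Fin (M.size (m + 1) t) × Fin (M.size (m + 1) t)) ∈ F
        · left
          rw [Finset.sum_eq_single_of_mem _ hF' h4]
          simp [hq, hq', p, M.e_mul_e]
        · right
          exact Finset.sum_eq_zero fun x hx => h4 x hx (by rintro rfl; exact hF' hx)
      · have h' : M.p m ⟨s, u⟩ * M.e n r i j * M.p m ⟨s, v⟩ = 0 := h
        right; rw [h']; simp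
    · right
      rw [corner_of_ne hl (by exact hs)]; simp

/-- Below a fixed deeper diagonal matrix unit, the columns of a summand are matrix units. -/
theorem exists_transfer (hU : ∀ n, A.toSubmodule ⊓ M.level n = M.upper n) {n m : ℕ} (hnm : n ≤ m)
    {r : Fin (M.blocks n)} {i : Fin (M.size n r)} {y : M.Idx m}
    (hy : M.p n ⟨r, i⟩ * M.p m y = M.p m y) (s : Fin (M.size n r)) :
    ∃ s' : Fin (M.size m y.1), M.e n r s i * M.p m y = M.e m y.1 s' y.2 := by
  classical
  obtain ⟨t, l⟩ := y
  have hl := level_mono hnm (e_mem_level (M := M) n r s i)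
  set v := M.e n r s i with hv
  set q := M.p m ⟨t, l⟩ with hq
  let T : Finset (Fin (M.size m t)) :=
    Finset.univ.filter fun k => M.e m t k k * v * M.e m t l l = M.e m t k l
  have h1 : v * q = ∑ k ∈ T, M.e m t k l := by
    conv_lhs => rw [← one_mul_of_mem hl, one, Finset.sum_mul, Finset.sum_mul, Fintype.sum_sigma]
    rw [Finset.sum_eq_single t]
    · rw [Finset.sum_filter]
      refine Finset.sum_congr rfl fun k _ => ?_
      split_ifs with h
      · exact h
      · exact (corner_e hU hnm r s i t k l).resolve_left h
    · intro t' _ ht'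
      exact Finset.sum_eq_zero fun k _ => corner_of_ne hl ht'
    · simp
  have h2 : star (v * q) * (v * q) = q := by
    rw [star_mul, star_p, hv, M.star_e, mul_assoc, ← mul_assoc (M.e n r i s), M.e_mul_e,
      if_pos rfl]
    change q * (M.p n ⟨r, i⟩ * q) = q
    rw [hy, p_mul_self]
  -- The column has entries zero and one, and `star (v * q) * (v * q)` counts the ones; since it
  -- equals `q`, there is exactly one.
  have h3 : (T.card : ℂ) • q = q := by
    conv_rhs => rw [← h2, h1, star_sum, Finset.sum_mul]
    rw [Finset.sum_congr rfl (g := fun _ => q), Finset.sum_const, Nat.cast_smul_eq_nsmul]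
    intro k hk
    rw [Finset.mul_sum, Finset.sum_eq_single_of_mem k hk]
    · simp [M.star_e, M.e_mul_e, hq, p]
    · intro k' _ hk'
      simp [M.star_e, M.e_mul_e, hk'.symm]
  have h4 : T.card = 1 := by
    have := smul_left_injective ℂ (p_ne_zero m ⟨t, l⟩) (h3.trans (one_smul ℂ q).symm)
    exact_mod_cast this
  obtain ⟨k, hk⟩ := Finset.card_eq_one.1 h4
  exact ⟨k, by rw [h1, hk, Finset.sum_singleton]⟩

theorem transfer_mul {n m : ℕ} {r : Fin (M.blocks n)} {i : Fin (M.size n r)} {y : M.Idx m}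
    {s t : Fin (M.size n r)} {s' t' : Fin (M.size m y.1)}
    (hs : M.e n r s i * M.p m y = M.e m y.1 s' y.2)
    (ht : M.e n r t i * M.p m y = M.e m y.1 t' y.2) :
    M.e n r s i * M.p m y * M.e n r i t = M.e m y.1 s' t' := by
  have h := congrArg star ht
  rw [star_mul, star_p, M.star_e, M.star_e] at h
  calc _ = (M.e n r s i * M.p m y) * (M.p m y * M.e n r i t) := by
        rw [← mul_assoc, mul_assoc _ (M.p m y) (M.p m y), p_mul_self]
    _ = _ := by rw [h, hs, M.e_mul_e, if_pos rfl]

/-- For `s ≤ t` the unit `e_{s't'}` of `𝔄ₘ` is the product of `M.e n r s t` with a diagonal unit, so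
it lies in `A` and is upper triangular. -/
theorem transfer_mono (hU : ∀ n, A.toSubmodule ⊓ M.level n = M.upper n) {n m : ℕ}
    {r : Fin (M.blocks n)} {i : Fin (M.size n r)} {y : M.Idx m}
    {s t : Fin (M.size n r)} {s' t' : Fin (M.size m y.1)}
    (hs : M.e n r s i * M.p m y = M.e m y.1 s' y.2)
    (ht : M.e n r t i * M.p m y = M.e m y.1 t' y.2) (hst : s ≤ t) : s' ≤ t' := by
  have h1 : M.e n r s t * M.p m ⟨y.1, t'⟩ = M.e m y.1 s' t' := by
    have : M.p m ⟨y.1, t'⟩ = M.e n r t i * M.p m y * M.e n r i t := (transfer_mul ht ht).symm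
    rw [this, ← mul_assoc, ← mul_assoc, M.e_mul_e, if_pos rfl, transfer_mul hs ht]
  rw [← e_mem_iff hU, ← h1]
  exact mul_mem (e_mem hU hst) (p_mem hU _ _)

end AFSystem

/-! ### Closed ideals and nearby matrix units. -/

/-- A closed two-sided ideal of `A`, as a subspace of the ambient algebra. -/
structure IsClosedIdeal {𝔄 : Type*} [NonUnitalCStarAlgebra 𝔄] (A : NonUnitalSubalgebra ℂ 𝔄)
    (I : Submodule ℂ 𝔄) : Prop where
  le : I ≤ A.toSubmodule
  isClosed : IsClosed (I : Set 𝔄)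
  mul_left : ∀ a ∈ A, ∀ b ∈ I, a * b ∈ I
  mul_right : ∀ a ∈ A, ∀ b ∈ I, b * a ∈ I

namespace AFSystem

variable {𝔄 : Type*} [NonUnitalCStarAlgebra 𝔄] {M : AFSystem 𝔄} {A : NonUnitalSubalgebra ℂ 𝔄}

theorem exists_approx (hA : IsTAF M A) {a : 𝔄} (ha : a ∈ A) {ε : ℝ} (hε : 0 < ε) (n : ℕ) :
    ∃ m, n ≤ m ∧ ∃ w ∈ A, w ∈ M.level m ∧ ‖a - w‖ < ε := by
  obtain ⟨w, hw, hd⟩ := Metric.mem_closure_iff.1 (hA.limit ha) ε hε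
  obtain ⟨k, hk⟩ := Set.mem_iUnion.1 hw
  exact ⟨max n k, le_max_left _ _, w, hk.1, level_mono (le_max_right _ _) hk.2,
    by rwa [← dist_eq_norm]⟩

/-- The matrix unit of `𝔄ₘ` below the matrix unit `e n r s t` which is singled out by the diagonal
matrix unit `y` of `𝔄ₘ`. -/
def sub (M : AFSystem 𝔄) (n m : ℕ) (x : M.Idx n) (y : M.Idx m) (s t : Fin (M.size n x.1)) : 𝔄 :=
  M.e n x.1 s x.2 * M.p m y * M.e n x.1 x.2 t

theorem star_subunit (n m : ℕ) (x : M.Idx n) (y : M.Idx m) (s t : Fin (M.size n x.1)) :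
    star (M.sub n m x y s t) = M.sub n m x y t s := by
  simp [sub, star_p, M.star_e, mul_assoc]

/-- Each `y` below `x` contributes its own copy of a full system of matrix units, and copies for
different `y` are orthogonal. -/
theorem sub_mul_sub {n m : ℕ} {x : M.Idx n} {y y' : M.Idx m}
    (hy : M.p n x * M.p m y' = M.p m y') (s t u v : Fin (M.size n x.1)) :
    M.sub n m x y s t * M.sub n m x y' u v =
      if t = u ∧ y = y' then M.sub n m x y s v else 0 := by
  have h : M.sub n m x y s t * M.sub n m x y' u v = M.e n x.1 s x.2 * (M.p m y *
      (M.e n x.1 x.2 t * M.e n x.1 u x.2) * M.p m y') * M.e n x.1 x.2 v := by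
    simp only [sub, mul_assoc]
  rw [h, M.e_mul_e]
  by_cases htu : t = u
  · change (_ * (_ * (if _ then M.p n x else 0) * _) * _ = _)
    rw [if_pos htu, mul_assoc (M.p m y), hy, p_mul_p]
    by_cases hyy : y = y'
    · subst hyy; simp [htu, sub]
    · simp [hyy]
  · simp [htu]

theorem sub_mul_sub_of_ne {n m : ℕ} {x x' : M.Idx n} (hx : x.1 ≠ x'.1) (y y' : M.Idx m)
    (s t : Fin (M.size n x.1)) (u v : Fin (M.size n x'.1)) :
    M.sub n m x y s t * M.sub n m x' y' u v = 0 := by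
  have h : M.sub n m x y s t * M.sub n m x' y' u v = M.e n x.1 s x.2 * (M.p m y *
      (M.e n x.1 x.2 t * M.e n x'.1 u x'.2) * M.p m y') * M.e n x'.1 x'.2 v := by
    simp only [sub, mul_assoc]
  rw [h, M.e_mul_e_of_ne _ _ _ _ _ _ _ hx]; simp

theorem exists_sub_eq (hU : ∀ n, A.toSubmodule ⊓ M.level n = M.upper n) {n m : ℕ} (hnm : n ≤ m)
    {x : M.Idx n} {y : M.Idx m} (hy : M.p n x * M.p m y = M.p m y) (s t : Fin (M.size n x.1)) :
    ∃ s' t', M.sub n m x y s t = M.e m y.1 s' t' ∧ M.sub n m x y s s = M.p m ⟨y.1, s'⟩ ∧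
      M.sub n m x y t t = M.p m ⟨y.1, t'⟩ := by
  obtain ⟨s', hs⟩ := exists_transfer hU hnm hy s
  obtain ⟨t', ht⟩ := exists_transfer hU hnm hy t
  exact ⟨s', t', transfer_mul hs ht, transfer_mul hs hs, transfer_mul ht ht⟩

theorem sub_self_mem (hU : ∀ n, A.toSubmodule ⊓ M.level n = M.upper n) {n m : ℕ} (hnm : n ≤ m)
    {x : M.Idx n} {y : M.Idx m} (hy : M.p n x * M.p m y = M.p m y) (s : Fin (M.size n x.1)) :
    M.sub n m x y s s ∈ A := by
  obtain ⟨s', t', -, h, -⟩ := exists_sub_eq hU hnm hy s s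
  rw [h]; exact p_mem hU _ _

theorem exists_corner_sub (hU : ∀ n, A.toSubmodule ⊓ M.level n = M.upper n) {n m : ℕ}
    (hnm : n ≤ m) {x : M.Idx n} {y : M.Idx m} (hy : M.p n x * M.p m y = M.p m y)
    (s t : Fin (M.size n x.1)) {a : 𝔄} (ha : a ∈ M.level m) :
    ∃ c : ℂ, M.sub n m x y s s * a * M.sub n m x y t t = c • M.sub n m x y s t := by
  obtain ⟨s', t', h, hs, ht⟩ := exists_sub_eq hU hnm hy s t
  rw [h, hs, ht]
  exact exists_corner ha _ _ _

theorem norm_sub_eq (hU : ∀ n, A.toSubmodule ⊓ M.level n = M.upper n) {n m : ℕ}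
    (hnm : n ≤ m) {x : M.Idx n} {y : M.Idx m} (hy : M.p n x * M.p m y = M.p m y)
    (s t : Fin (M.size n x.1)) : ‖M.sub n m x y s t‖ = 1 := by
  obtain ⟨s', t', h, -, -⟩ := exists_sub_eq hU hnm hy s t
  rw [h, norm_e]

open Classical in
theorem sum_sub (hU : ∀ n, A.toSubmodule ⊓ M.level n = M.upper n) {n m : ℕ} (hnm : n ≤ m)
    (x : M.Idx n) (s t : Fin (M.size n x.1)) :
    ∑ y : M.Idx m with M.p n x * M.p m y = M.p m y, M.sub n m x y s t = M.e n x.1 s t := by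
  simp only [sub]
  rw [← Finset.sum_mul, ← Finset.mul_sum, ← p_eq_sum hU hnm x]
  simp [p, M.e_mul_e]

/-- A closed ideal contains every matrix unit to which it comes close. -/
theorem e_mem_of_norm_sub_le (hA : IsTAF M A)
    (hU : ∀ n, A.toSubmodule ⊓ M.level n = M.upper n) {I : Submodule ℂ 𝔄}
    (hI : IsClosedIdeal A I) {n : ℕ} {r : Fin (M.blocks n)} {i j : Fin (M.size n r)} {z : 𝔄}
    (hz : z ∈ I) (hze : ‖z - M.e n r i j‖ ≤ 1 / 4) : M.e n r i j ∈ I := by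
  classical
  suffices h : ∀ δ : ℝ, 0 < δ → δ ≤ 1 / 4 → ∃ b ∈ I, ‖M.e n r i j - b‖ ≤ 2 * δ by
    have : M.e n r i j ∈ closure (I : Set 𝔄) := by
      refine Metric.mem_closure_iff.2 fun ε hε => ?_
      obtain ⟨b, hb, hd⟩ := h (min (ε / 4) (1 / 4)) (by positivity) (min_le_right _ _)
      refine ⟨b, hb, ?_⟩
      rw [dist_eq_norm]
      have := min_le_left (ε / 4) (1 / 4)
      linarith
    rwa [hI.isClosed.closure_eq] at this
  intro δ hδ hδ'
  obtain ⟨m, hnm, w, hwA, hwm, hw⟩ := exists_approx hA (hI.le hz) hδ n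
  let x : M.Idx n := ⟨r, j⟩
  let Y : Finset (M.Idx m) := Finset.univ.filter fun y => M.p n x * M.p m y = M.p m y
  have hY : ∀ y ∈ Y, M.p n x * M.p m y = M.p m y := fun y hy => (Finset.mem_filter.1 hy).2
  -- `C` keeps only the coefficients along the deeper units that make up `e n r i j`. It is
  -- contractive, being multiplication by `e n r j i`, a pinching, and multiplication by `e n r i
  -- j`.
  let C : 𝔄 → 𝔄 := fun a => ∑ y ∈ Y, M.sub n m x y i i * a * M.sub n m x y j j
  have hjj : ∀ y ∈ Y, M.sub n m x y j j = M.p m y := fun y hy => by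
    change M.p n x * M.p m y * M.p n x = _
    rw [hY y hy, p_mul_p_comm_of_eq (hY y hy)]
  have hC : ∀ a, C a = M.e n r i j * ∑ y ∈ Y, M.p m y * (M.e n r j i * a) * M.p m y := fun a => by
    rw [Finset.mul_sum]
    refine Finset.sum_congr rfl fun y hy => ?_
    rw [hjj y hy]
    simp only [sub, mul_assoc, x]
  have hCn : ∀ a, ‖C a‖ ≤ ‖a‖ := fun a => by
    rw [hC]
    refine (norm_mul_le _ _).trans ?_
    rw [norm_e, one_mul]
    refine (norm_sum_pinch_le Y (M.p m) (fun y _ => star_p m y) (fun y _ => p_mul_self m y)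
      (fun y _ y' _ h => p_mul_p_of_ne h) _).trans ?_
    refine (norm_mul_le _ _).trans ?_
    rw [norm_e, one_mul]
  have hCs : ∀ a b, C (a - b) = C a - C b := fun a b => by
    simp only [C, mul_sub, sub_mul, Finset.sum_sub_distrib]
  have hl : ∀ y : M.Idx m, ∃ c : ℂ, y ∈ Y →
      M.sub n m x y i i * w * M.sub n m x y j j = c • M.sub n m x y i j := fun y => by
    by_cases hy : y ∈ Y
    · obtain ⟨c, hc⟩ := exists_corner_sub hU hnm (hY y hy) i j hwm
      exact ⟨c, fun _ => hc⟩
    · exact ⟨0, fun h => absurd h hy⟩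
  choose c hc using hl
  have hwe : ‖w - M.e n r i j‖ ≤ 1 / 2 := by
    have := norm_add_le (w - z) (z - M.e n r i j)
    rw [sub_add_sub_cancel, norm_sub_rev w z] at this
    linarith
  have hc1 : ∀ y ∈ Y, ‖c y - 1‖ ≤ 1 / 2 := fun y hy => by
    have h1 : M.sub n m x y i i * M.e n r i j * M.sub n m x y j j = M.sub n m x y i j := by
      have : M.sub n m x y i i * M.e n r i j = M.sub n m x y i j := by
        simp only [sub, x, mul_assoc, M.e_mul_e, if_true]
      rw [this, sub_mul_sub (hY y hy)]; simp
    have h2 : M.sub n m x y i i * (w - M.e n r i j) * M.sub n m x y j j =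
        (c y - 1) • M.sub n m x y i j := by
      rw [mul_sub, sub_mul, hc y hy, h1, sub_smul, one_smul]
    have h3 := congrArg norm h2
    rw [norm_smul, norm_sub_eq hU hnm (hY y hy), mul_one] at h3
    rw [← h3]
    refine (norm_mul_le _ _).trans ?_
    rw [norm_sub_eq hU hnm (hY y hy), mul_one]
    refine (norm_mul_le _ _).trans ?_
    rwa [norm_sub_eq hU hnm (hY y hy), one_mul]
  have hc2 : ∀ y ∈ Y, 1 / 2 ≤ ‖c y‖ := fun y hy => by
    have h1 := norm_add_le (1 - c y) (c y)
    rw [sub_add_cancel, norm_one, norm_sub_rev] at h1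
    linarith [hc1 y hy]
  -- The coefficients of `C w` lie within `1/2` of `1`, so they can be inverted by a diagonal
  -- element of norm at most `2`. Then `C w * g` is the unit itself, while `C z * g` lies in `I` at
  -- distance at most `2 * δ`.
  let g : 𝔄 := ∑ y ∈ Y, (c y)⁻¹ • M.p m y
  have hg : ‖g‖ ≤ 2 := by
    refine norm_sum_smul_le Y (M.p m) (fun y _ => star_p m y) (fun y _ => p_mul_self m y)
      (fun y _ y' _ h => p_mul_p_of_ne h) _ (by norm_num) fun y hy => ?_
    rw [norm_inv]
    exact inv_le_of_inv_le₀ (by norm_num) (by linarith [hc2 y hy])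
  have hgA : g ∈ A := sum_mem fun y _ => A.toSubmodule.smul_mem _ (p_mem hU m y)
  have hCw : C w * g = M.e n r i j := by
    rw [Finset.sum_mul, ← sum_sub hU hnm x i j]
    refine Finset.sum_congr rfl fun y hy => ?_
    have hy0 : c y ≠ 0 := norm_pos_iff.1 (by linarith [hc2 y hy])
    rw [hc y hy, Finset.mul_sum, Finset.sum_eq_single_of_mem y hy]
    · rw [← hjj y hy, smul_mul_smul_comm, sub_mul_sub (hY y hy), mul_inv_cancel₀ hy0]
      simp
    · intro y' hy' hne
      rw [← hjj y' hy', smul_mul_smul_comm, sub_mul_sub (hY y' hy')]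
      simp [hne.symm]
  refine ⟨C z * g, hI.mul_right g hgA _ (Submodule.sum_mem _ fun y hy => ?_), ?_⟩
  · exact hI.mul_right _ (sub_self_mem hU hnm (hY y hy) j) _
      (hI.mul_left _ (sub_self_mem hU hnm (hY y hy) i) _ hz)
  · rw [← hCw, ← sub_mul, ← hCs]
    calc _ ≤ ‖C (w - z)‖ * ‖g‖ := norm_mul_le _ _
      _ ≤ δ * 2 := by
        gcongr
        refine (hCn _).trans ?_
        rw [norm_sub_rev]; exact hw.le
      _ = _ := by ring

end AFSystem

/-! ### Pinching by the commutant of `𝔄ₙ`; closed ideals are spanned by matrix units. -/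

namespace AFSystem

variable {𝔄 : Type*} [NonUnitalCStarAlgebra 𝔄] {M : AFSystem 𝔄} {A : NonUnitalSubalgebra ℂ 𝔄}

open Classical in
/-- The minimal projections of the commutant of `𝔄ₙ` in the diagonal of `𝔄ₘ`, indexed by the
diagonal matrix units of `𝔄ₘ` below the first diagonal matrix unit of some summand of `𝔄ₙ`. -/
noncomputable def pinchIdx (M : AFSystem 𝔄) (n m : ℕ) : Finset (M.Idx n × M.Idx m) :=
  Finset.univ.filter fun k => k.1.2.val = 0 ∧ M.p n k.1 * M.p m k.2 = M.p m k.2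

/-- The projection of the commutant of `𝔄ₙ` given by an index of `pinchIdx`. -/
def pinchProj (M : AFSystem 𝔄) (n m : ℕ) (k : M.Idx n × M.Idx m) : 𝔄 :=
  ∑ s, M.sub n m k.1 k.2 s s

/-- The pinching of an element by the projections `pinchProj`. -/
noncomputable def pinch (M : AFSystem 𝔄) (n m : ℕ) (a : 𝔄) : 𝔄 :=
  ∑ k ∈ M.pinchIdx n m, M.pinchProj n m k * a * M.pinchProj n m k

theorem mem_pinchIdx {n m : ℕ} {k : M.Idx n × M.Idx m} : k ∈ M.pinchIdx n m ↔
    k.1.2.val = 0 ∧ M.p n k.1 * M.p m k.2 = M.p m k.2 := by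
  simp [pinchIdx]

theorem star_pinchProj (n m : ℕ) (k : M.Idx n × M.Idx m) :
    star (M.pinchProj n m k) = M.pinchProj n m k := by
  simp [pinchProj, star_subunit]

theorem pinchProj_mul_sub {n m : ℕ} {k : M.Idx n × M.Idx m} (hk : k ∈ M.pinchIdx n m)
    (s t : Fin (M.size n k.1.1)) :
    M.pinchProj n m k * M.sub n m k.1 k.2 s t = M.sub n m k.1 k.2 s t := by
  simp [pinchProj, Finset.sum_mul, sub_mul_sub (mem_pinchIdx.1 hk).2]

theorem pinchProj_mul_self {n m : ℕ} {k : M.Idx n × M.Idx m} (hk : k ∈ M.pinchIdx n m) :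
    M.pinchProj n m k * M.pinchProj n m k = M.pinchProj n m k := by
  change M.pinchProj n m k * ∑ s, M.sub n m k.1 k.2 s s = ∑ s, M.sub n m k.1 k.2 s s
  rw [Finset.mul_sum]
  exact Finset.sum_congr rfl fun s _ => pinchProj_mul_sub hk s s

theorem pinchProj_mul_of_ne {n m : ℕ} {k l : M.Idx n × M.Idx m} (hk : k ∈ M.pinchIdx n m)
    (hl : l ∈ M.pinchIdx n m) (hkl : k ≠ l) : M.pinchProj n m k * M.pinchProj n m l = 0 := by
  rw [pinchProj, pinchProj, Finset.sum_mul]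
  refine Finset.sum_eq_zero fun s _ => ?_
  rw [Finset.mul_sum]
  refine Finset.sum_eq_zero fun t _ => ?_
  obtain ⟨⟨r, i⟩, y⟩ := k
  obtain ⟨⟨r', i'⟩, y'⟩ := l
  have h1 := mem_pinchIdx.1 hk
  have h2 := mem_pinchIdx.1 hl
  by_cases hr : r = r'
  · subst hr
    obtain rfl : i = i' := Fin.ext (h1.1.trans h2.1.symm)
    have hy : y ≠ y' := fun h => hkl (by rw [h])
    simp only [sub_mul_sub h2.2, hy, and_false, if_false]
  · exact sub_mul_sub_of_ne hr _ _ _ _ _ _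

theorem norm_pinch_le (n m : ℕ) (a : 𝔄) : ‖M.pinch n m a‖ ≤ ‖a‖ :=
  norm_sum_pinch_le _ _ (fun k _ => star_pinchProj n m k) (fun _ hk => pinchProj_mul_self hk)
    (fun _ hk _ hl h => pinchProj_mul_of_ne hk hl h) a

theorem pinch_sub (n m : ℕ) (a b : 𝔄) : M.pinch n m (a - b) = M.pinch n m a - M.pinch n m b := by
  simp only [pinch, mul_sub, sub_mul, Finset.sum_sub_distrib]

theorem pinch_eq_sum (n m : ℕ) (a : 𝔄) : M.pinch n m a = ∑ k ∈ M.pinchIdx n m, ∑ s, ∑ t,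
    M.sub n m k.1 k.2 s s * a * M.sub n m k.1 k.2 t t := by
  simp only [pinch, pinchProj, Finset.sum_mul, Finset.mul_sum]
  exact Finset.sum_congr rfl fun k _ => Finset.sum_comm

open Classical in
theorem sum_pinchIdx {E : Type*} [AddCommMonoid E] (n m : ℕ) (f : M.Idx n → M.Idx m → E) :
    ∑ k ∈ M.pinchIdx n m, f k.1 k.2 = ∑ x : M.Idx n with x.2.val = 0,
      ∑ y : M.Idx m with M.p n x * M.p m y = M.p m y, f x y := by
  rw [pinchIdx, Finset.sum_filter, Fintype.sum_prod_type, Finset.sum_filter]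
  refine Finset.sum_congr rfl fun x _ => ?_
  rw [Finset.sum_filter]
  by_cases hx : x.2.val = 0 <;> simp [hx]

theorem pinch_e (hU : ∀ n, A.toSubmodule ⊓ M.level n = M.upper n) {n m : ℕ} (hnm : n ≤ m)
    (r : Fin (M.blocks n)) (i j : Fin (M.size n r)) :
    M.pinch n m (M.e n r i j) = M.e n r i j := by
  classical
  rw [pinch_eq_sum, sum_pinchIdx (M := M) n m fun x y => ∑ s, ∑ t,
    M.sub n m x y s s * M.e n r i j * M.sub n m x y t t]
  let l : Fin (M.size n r) := ⟨0, i.pos⟩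
  rw [Finset.sum_eq_single_of_mem (⟨r, l⟩ : M.Idx n) (by simp [l])]
  · refine Eq.trans ?_ (sum_sub hU hnm ⟨r, l⟩ i j)
    refine Finset.sum_congr rfl fun y hy => ?_
    have hy := (Finset.mem_filter.1 hy).2
    have h1 : ∀ s, M.sub n m ⟨r, l⟩ y s s * M.e n r i j =
        if s = i then M.sub n m ⟨r, l⟩ y i j else 0 := fun s => by
      simp only [sub, mul_assoc, M.e_mul_e]
      split_ifs with h
      · rw [h]
      · simp
    simp only [h1]
    rw [Finset.sum_eq_single_of_mem i (Finset.mem_univ _),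
      Finset.sum_eq_single_of_mem j (Finset.mem_univ _)]
    · rw [if_pos rfl, sub_mul_sub hy]; simp
    · intro t _ ht
      rw [if_pos rfl, sub_mul_sub hy]; simp [ht.symm]
    · intro s _ hs
      simp [hs]
  · rintro ⟨r', l'⟩ hl' hne
    have hr : r' ≠ r := by
      rintro rfl
      exact hne (by rw [Fin.ext (a := l') (b := l) (Finset.mem_filter.1 hl').2])
    refine Finset.sum_eq_zero fun y _ => Finset.sum_eq_zero fun s _ => Finset.sum_eq_zero
      fun t _ => ?_
    simp only [sub, mul_assoc]
    rw [← mul_assoc (M.e n r' l' s), M.e_mul_e_of_ne _ _ _ _ _ _ _ hr]; simp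

theorem pinch_of_mem (hU : ∀ n, A.toSubmodule ⊓ M.level n = M.upper n) {n m : ℕ} (hnm : n ≤ m)
    {a : 𝔄} (ha : a ∈ M.level n) : M.pinch n m a = a := by
  induction ha using Submodule.span_induction with
  | mem x h => obtain ⟨r, i, j, rfl⟩ := h; exact pinch_e hU hnm r i j
  | zero => simp [pinch]
  | add x y _ _ hx hy =>
    have : x + y = x - (0 - y) := by abel
    rw [this, pinch_sub, pinch_sub, hx, hy]; simp [pinch]
  | smul c x _ hx =>
    simp only [pinch, mul_smul_comm, smul_mul_assoc] at hx ⊢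
    rw [← Finset.smul_sum, hx]

/-- An upper bound for the number of matrix units of `𝔄ₙ`. -/
def unitCount (M : AFSystem 𝔄) (n : ℕ) : ℝ :=
  ∑ x : M.Idx n, ∑ _s : Fin (M.size n x.1), ∑ _t : Fin (M.size n x.1), (1 : ℝ)

theorem unitCount_nonneg (n : ℕ) : 0 ≤ M.unitCount n :=
  Finset.sum_nonneg fun _ _ => Finset.sum_nonneg fun _ _ => Finset.sum_nonneg fun _ _ => zero_le_one

/-- For a fixed `x` and position `(s, t)`, the sum over `y` is a combination of orthogonal
projections between two units, so its norm is at most the largest coefficient. The resulting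
constant does not depend on `m`. -/
theorem norm_sum_smul_sub_le (n m : ℕ)
    (d : (k : M.Idx n × M.Idx m) → Fin (M.size n k.1.1) → Fin (M.size n k.1.1) → ℂ) {C : ℝ}
    (hC : 0 ≤ C) (hd : ∀ k s t, ‖d k s t‖ ≤ C) :
    ‖∑ k ∈ M.pinchIdx n m, ∑ s, ∑ t, d k s t • M.sub n m k.1 k.2 s t‖ ≤ M.unitCount n * C := by
  classical
  have h1 : ∑ k ∈ M.pinchIdx n m, ∑ s, ∑ t, d k s t • M.sub n m k.1 k.2 s t =
      ∑ x : M.Idx n with x.2.val = 0, ∑ s, ∑ t, M.e n x.1 s x.2 *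
        (∑ y : M.Idx m with M.p n x * M.p m y = M.p m y, d (x, y) s t • M.p m y) *
          M.e n x.1 x.2 t := by
    refine (sum_pinchIdx (M := M) n m fun x y => ∑ s : Fin (M.size n x.1), ∑ t : Fin (M.size n x.1),
      d (x, y) s t • M.sub n m x y s t).trans ?_
    refine Finset.sum_congr rfl fun x _ => ?_
    refine Finset.sum_comm.trans (Finset.sum_congr rfl fun s _ => ?_)
    refine Finset.sum_comm.trans (Finset.sum_congr rfl fun t _ => ?_)
    rw [Finset.mul_sum, Finset.sum_mul]
    refine Finset.sum_congr rfl fun y _ => ?_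
    rw [mul_smul_comm, smul_mul_assoc, sub]
  rw [h1]
  have h2 : ∀ x : M.Idx n, ‖∑ s, ∑ t, M.e n x.1 s x.2 *
      (∑ y : M.Idx m with M.p n x * M.p m y = M.p m y, d (x, y) s t • M.p m y) *
        M.e n x.1 x.2 t‖ ≤
      ∑ _s : Fin (M.size n x.1), ∑ _t : Fin (M.size n x.1), C := fun x => by
    refine norm_sum_le_of_le _ fun s _ => norm_sum_le_of_le _ fun t _ => ?_
    refine (norm_mul_le _ _).trans ?_
    rw [norm_e, mul_one]
    refine (norm_mul_le _ _).trans ?_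
    rw [norm_e, one_mul]
    exact norm_sum_smul_le _ (M.p m) (fun y _ => star_p m y) (fun y _ => p_mul_self m y)
      (fun y _ y' _ h => p_mul_p_of_ne h) _ hC fun y _ => hd _ _ _
  refine (norm_sum_le_of_le _ fun x _ => h2 x).trans ?_
  refine (Finset.sum_le_sum_of_subset_of_nonneg (Finset.filter_subset _ _)
    fun x _ _ => Finset.sum_nonneg fun _ _ => Finset.sum_nonneg fun _ _ => hC).trans (le_of_eq ?_)
  simp only [unitCount, Finset.sum_mul, one_mul]

/-- The span of the matrix units in `I`. -/
def unitSpan (M : AFSystem 𝔄) (I : Submodule ℂ 𝔄) : Submodule ℂ 𝔄 :=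
  Submodule.span ℂ {x | x ∈ I ∧ ∃ n r i j, x = M.e n r i j}

/-- Closed ideals are generated by the matrix units they contain. -/
theorem le_closure_unitSpan (hA : IsTAF M A)
    (hU : ∀ n, A.toSubmodule ⊓ M.level n = M.upper n) {I : Submodule ℂ 𝔄}
    (hI : IsClosedIdeal A I) : I ≤ (M.unitSpan I).topologicalClosure := by
  classical
  intro a ha
  refine Metric.mem_closure_iff.2 fun ε' hε' => ?_
  obtain ⟨ε, hε, rfl⟩ : ∃ ε : ℝ, 0 < ε ∧ 5 * ε = ε' := ⟨ε' / 5, by positivity, by ring⟩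
  obtain ⟨n, -, an, -, han, hn⟩ := exists_approx hA (hI.le ha) hε 0
  have hK : 0 ≤ M.unitCount n := unitCount_nonneg n
  -- The discarded coefficients are at most `4 * δ`, so the discarded sum has norm at most `ε`. This
  -- is possible because the constant depends on `n` alone and `m` is chosen after `δ`.
  let δ : ℝ := ε / (4 * M.unitCount n + 1)
  have hδ : 0 < δ := by positivity
  have hδε : δ ≤ ε := div_le_self hε.le (by linarith)
  have hKδ : M.unitCount n * (4 * δ) ≤ ε := by
    have : δ * (4 * M.unitCount n + 1) = ε := div_mul_cancel₀ _ (by positivity)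
    nlinarith
  obtain ⟨m, hnm, w, hwA, hwm, hw⟩ := exists_approx hA (hI.le ha) hδ n
  have hc : ∀ (k : M.Idx n × M.Idx m) (s t : Fin (M.size n k.1.1)), ∃ c : ℂ,
      k ∈ M.pinchIdx n m → M.sub n m k.1 k.2 s s * w * M.sub n m k.1 k.2 t t =
        c • M.sub n m k.1 k.2 s t := fun k s t => by
    by_cases hk : k ∈ M.pinchIdx n m
    · obtain ⟨c, hc⟩ := exists_corner_sub hU hnm (mem_pinchIdx.1 hk).2 s t hwm
      exact ⟨c, fun _ => hc⟩
    · exact ⟨0, fun h => absurd h hk⟩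
  choose c hc using hc
  -- A corner of `a` lies in `I` within `δ` of `c` times a unit; dividing by `c`, with `4 * δ <
  -- ‖c‖`, brings it within `1/4` of the unit.
  have hgood : ∀ k ∈ M.pinchIdx n m, ∀ s t, 4 * δ < ‖c k s t‖ →
      M.sub n m k.1 k.2 s t ∈ M.unitSpan I := by
    intro k hk s t hcst
    have hy := (mem_pinchIdx.1 hk).2
    have hc0 : c k s t ≠ 0 := norm_pos_iff.1 (by linarith)
    set z := M.sub n m k.1 k.2 s s * a * M.sub n m k.1 k.2 t t with hz
    have hzI : z ∈ I := hI.mul_right _ (sub_self_mem hU hnm hy t) _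
      (hI.mul_left _ (sub_self_mem hU hnm hy s) _ ha)
    have hzn : ‖z - c k s t • M.sub n m k.1 k.2 s t‖ ≤ δ := by
      rw [← hc k s t hk, hz, ← sub_mul, ← mul_sub]
      refine (norm_mul_le _ _).trans ?_
      rw [norm_sub_eq hU hnm hy, mul_one]
      refine (norm_mul_le _ _).trans ?_
      rw [norm_sub_eq hU hnm hy, one_mul]
      exact hw.le
    obtain ⟨s', t', h, -, -⟩ := exists_sub_eq hU hnm hy s t
    refine Submodule.subset_span ⟨?_, m, k.2.1, s', t', h⟩
    rw [h] at hzn ⊢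
    refine e_mem_of_norm_sub_le hA hU hI (I.smul_mem (c k s t)⁻¹ hzI) ?_
    have h1 : (c k s t)⁻¹ • z - M.e m k.2.1 s' t' =
        (c k s t)⁻¹ • (z - c k s t • M.e m k.2.1 s' t') := by
      rw [smul_sub, smul_smul, inv_mul_cancel₀ hc0, one_smul]
    rw [h1, norm_smul, norm_inv, inv_mul_le_iff₀ (by linarith)]
    linarith
  let g : 𝔄 := ∑ k ∈ M.pinchIdx n m, ∑ s, ∑ t,
    (if 4 * δ < ‖c k s t‖ then c k s t else 0) • M.sub n m k.1 k.2 s t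
  let b : 𝔄 := ∑ k ∈ M.pinchIdx n m, ∑ s, ∑ t,
    (if 4 * δ < ‖c k s t‖ then 0 else c k s t) • M.sub n m k.1 k.2 s t
  have hgb : M.pinch n m w = g + b := by
    rw [pinch_eq_sum]
    simp only [g, b, ← Finset.sum_add_distrib]
    refine Finset.sum_congr rfl fun k hk => Finset.sum_congr rfl fun s _ =>
      Finset.sum_congr rfl fun t _ => ?_
    rw [hc k s t hk, ← add_smul]
    split_ifs <;> simp
  have hg : g ∈ M.unitSpan I := by
    refine Submodule.sum_mem _ fun k hk => Submodule.sum_mem _ fun s _ =>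
      Submodule.sum_mem _ fun t _ => ?_
    split_ifs with h
    · exact Submodule.smul_mem _ _ (hgood k hk s t h)
    · simp
  have hb : ‖b‖ ≤ M.unitCount n * (4 * δ) := by
    refine norm_sum_smul_sub_le n m _ (by positivity) fun k s t => ?_
    split_ifs with h
    · rw [norm_zero]; positivity
    · exact not_lt.1 h
  have e1 : ‖a - an‖ ≤ ε := hn.le
  -- The pinching fixes `an` because it uses projections commuting with `𝔄ₙ`.
  have e2 : ‖an - M.pinch n m a‖ ≤ ε := by
    have := norm_pinch_le (M := M) n m (an - a)
    rw [pinch_sub, pinch_of_mem hU hnm han, norm_sub_rev an a] at this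
    exact this.trans hn.le
  have e3 : ‖M.pinch n m a - M.pinch n m w‖ ≤ ε := by
    have := norm_pinch_le (M := M) n m (a - w)
    rw [pinch_sub] at this
    exact this.trans (hw.le.trans hδε)
  refine ⟨g, hg, ?_⟩
  rw [dist_eq_norm]
  have : a - g = (a - an) + (an - M.pinch n m a) + (M.pinch n m a - M.pinch n m w) + b := by
    rw [hgb]; abel
  rw [this]
  have := norm_add₄_le (a := a - an) (b := an - M.pinch n m a)
    (c := M.pinch n m a - M.pinch n m w) (d := b)
  linarith

/-- Closed ideals are compared on matrix units. -/
theorem le_of_e_mem (hA : IsTAF M A) (hU : ∀ n, A.toSubmodule ⊓ M.level n = M.upper n)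
    {I J : Submodule ℂ 𝔄} (hI : IsClosedIdeal A I) (hJ : IsClosed (J : Set 𝔄))
    (h : ∀ n r i j, M.e n r i j ∈ I → M.e n r i j ∈ J) : I ≤ J := by
  refine (le_closure_unitSpan hA hU hI).trans (Submodule.topologicalClosure_minimal _ ?_ hJ)
  refine Submodule.span_le.2 ?_
  rintro _ ⟨hx, n, r, i, j, rfl⟩
  exact h n r i j hx

end AFSystem

/-! ### Weak limits, and the passage between ring ideals and closed subspaces. -/

open Filter Topology InnerProductSpace

/-- Bounded sequences in a Hilbert space converge weakly along an ultrafilter. -/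
theorem exists_weak_limit {H : Type*} [NormedAddCommGroup H] [InnerProductSpace ℂ H]
    [CompleteSpace H] (u : ℕ → H) {C : ℝ} (hu : ∀ m, ‖u m‖ ≤ C) :
    ∃ z : H, ∀ v : H, Tendsto (fun m => ⟪v, u m⟫_ℂ) (hyperfilter ℕ) (𝓝 ⟪v, z⟫_ℂ) := by
  have h1 : ∀ v : H, ∃ c : ℂ, ‖c‖ ≤ C * ‖v‖ ∧
      Tendsto (fun m => ⟪u m, v⟫_ℂ) (hyperfilter ℕ) (𝓝 c) := fun v => by
    obtain ⟨c, hc, hl⟩ := (isCompact_closedBall (0 : ℂ) (C * ‖v‖)).ultrafilter_le_nhds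
      ((hyperfilter ℕ).map fun m => ⟪u m, v⟫_ℂ) (by
        rw [le_principal_iff]
        refine Filter.mem_map.2 (Eventually.of_forall fun m => ?_)
        rw [mem_closedBall_zero_iff]
        exact (norm_inner_le_norm _ _).trans (by gcongr; exact hu m))
    exact ⟨c, by simpa using hc, hl⟩
  choose φ hφ hl using h1
  let L : H →ₗ[ℂ] ℂ :=
    { toFun := φ
      map_add' := fun v w => by
        refine tendsto_nhds_unique (hl (v + w)) ?_
        simpa only [inner_add_right] using (hl v).add (hl w)
      map_smul' := fun c v => by
        refine tendsto_nhds_unique (hl (c • v)) ?_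
        simpa only [inner_smul_right, RingHom.id_apply, smul_eq_mul] using (hl v).const_mul c }
  refine ⟨(toDual ℂ H).symm (L.mkContinuous C hφ), fun v => ?_⟩
  have h2 : ⟪(toDual ℂ H).symm (L.mkContinuous C hφ), v⟫_ℂ = φ v := by
    rw [toDual_symm_apply]; rfl
  have h3 := (Complex.continuous_conj.tendsto _).comp (hl v)
  rw [← h2, inner_conj_symm] at h3
  refine h3.congr fun m => ?_
  simp [inner_conj_symm]

namespace AFSystem

variable {𝔄 : Type*} [NonUnitalCStarAlgebra 𝔄] {M : AFSystem 𝔄} {A : NonUnitalSubalgebra ℂ 𝔄}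

theorem norm_sum_p_le (m : ℕ) (F : Finset (M.Idx m)) : ‖∑ x ∈ F, M.p m x‖ ≤ 1 := by
  have := norm_sum_smul_le F (M.p m) (fun y _ => star_p m y) (fun y _ => p_mul_self m y)
      (fun y _ y' _ h => p_mul_p_of_ne h) (fun _ => 1) zero_le_one (by simp)
  simpa using this

/-- The identities of the algebras `𝔄ₙ` form an approximate identity of `A`. -/
theorem tendsto_one_mul (hA : IsTAF M A) {a : 𝔄} (ha : a ∈ A) :
    Tendsto (fun m => M.one m * a) atTop (𝓝 a) := by
  rw [Metric.tendsto_atTop]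
  intro ε hε
  obtain ⟨n, -, w, -, hw, hd⟩ := exists_approx hA ha (half_pos hε) 0
  refine ⟨n, fun m hm => ?_⟩
  have h1 : M.one m * a - a = M.one m * (a - w) - (a - w) := by
    rw [mul_sub, one_mul_of_mem (level_mono hm hw)]; abel
  rw [dist_eq_norm, h1]
  have h2 : ‖M.one m * (a - w)‖ ≤ ‖a - w‖ := (norm_mul_le _ _).trans
    (mul_le_of_le_one_left (norm_nonneg _) (norm_sum_p_le m Finset.univ))
  linarith [norm_sub_le (M.one m * (a - w)) (a - w)]

/-- A closed two-sided ideal of `A` is a subspace of the ambient algebra. -/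
theorem exists_isClosedIdeal (hA : IsTAF M A)
    (hU : ∀ n, A.toSubmodule ⊓ M.level n = M.upper n) {J : TwoSidedIdeal A}
    (hJ : IsClosed (J : Set A)) :
    ∃ I : Submodule ℂ 𝔄, IsClosedIdeal A I ∧ ∀ a : A, (a : 𝔄) ∈ I ↔ a ∈ J := by
  let S : Set 𝔄 := Subtype.val '' (J : Set A)
  have hS : IsClosed S := hA.isClosed.isClosedEmbedding_subtypeVal.isClosedMap _ hJ
  let I : Submodule ℂ 𝔄 :=
    { carrier := S
      zero_mem' := ⟨0, J.zero_mem, rfl⟩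
      add_mem' := by
        rintro _ _ ⟨a, ha, rfl⟩ ⟨b, hb, rfl⟩
        exact ⟨a + b, J.add_mem ha hb, rfl⟩
      smul_mem' := by
        rintro c _ ⟨a, ha, rfl⟩
        -- A ring ideal is not assumed stable under scalars: `c • a` is the limit of the products
        -- `(c • 1ₘ) * a`, which lie in `J`.
        have ht := (tendsto_one_mul hA a.2).const_smul c
        refine hS.mem_of_tendsto ht (Eventually.of_forall fun m => ?_)
        refine ⟨(c • (⟨M.one m, one_mem hU m⟩ : A)) * a, J.mul_mem_left _ _ ha, ?_⟩
        exact smul_mul_assoc c (M.one m) (a : 𝔄) }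
  refine ⟨I, ⟨?_, hS, ?_, ?_⟩, fun a => ⟨?_, fun h => ⟨a, h, rfl⟩⟩⟩
  · rintro _ ⟨a, -, rfl⟩; exact a.2
  · rintro b hb _ ⟨a, ha, rfl⟩
    exact ⟨⟨b, hb⟩ * a, J.mul_mem_left _ _ ha, rfl⟩
  · rintro b hb _ ⟨a, ha, rfl⟩
    exact ⟨a * ⟨b, hb⟩, J.mul_mem_right _ _ ha, rfl⟩
  · rintro ⟨b, hb, hba⟩
    rwa [← Subtype.ext hba]

end AFSystem

namespace IsClosedIdeal

variable {𝔄 : Type*} [NonUnitalCStarAlgebra 𝔄] {A : NonUnitalSubalgebra ℂ 𝔄}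

/-- A closed ideal as a two-sided ideal of the ring `A`. -/
def toTwoSidedIdeal {I : Submodule ℂ 𝔄} (hI : IsClosedIdeal A I) : TwoSidedIdeal A :=
  TwoSidedIdeal.mk' {a : A | (a : 𝔄) ∈ I} I.zero_mem (fun h h' => I.add_mem h h')
    (fun h => I.neg_mem h) (fun {x _} h => hI.mul_left x x.2 _ h)
    (fun {_ y} h => hI.mul_right y y.2 _ h)

theorem mem_toTwoSidedIdeal {I : Submodule ℂ 𝔄} (hI : IsClosedIdeal A I) (a : A) :
    a ∈ hI.toTwoSidedIdeal ↔ (a : 𝔄) ∈ I := by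
  simp [toTwoSidedIdeal]

theorem isClosed_toTwoSidedIdeal {I : Submodule ℂ 𝔄} (hI : IsClosedIdeal A I) :
    IsClosed (hI.toTwoSidedIdeal : Set A) := by
  have : (hI.toTwoSidedIdeal : Set A) = Subtype.val ⁻¹' (I : Set 𝔄) :=
    Set.ext fun a => hI.mem_toTwoSidedIdeal a
  rw [this]
  exact hI.isClosed.preimage continuous_subtype_val

theorem inf {I J : Submodule ℂ 𝔄} (hI : IsClosedIdeal A I) (hJ : IsClosedIdeal A J) :
    IsClosedIdeal A (I ⊓ J) where
  le := inf_le_left.trans hI.le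
  isClosed := hI.isClosed.inter hJ.isClosed
  mul_left a ha b hb := ⟨hI.mul_left a ha b hb.1, hJ.mul_left a ha b hb.2⟩
  mul_right a ha b hb := ⟨hI.mul_right a ha b hb.1, hJ.mul_right a ha b hb.2⟩

end IsClosedIdeal

/-! ### Kernels of bounded nest representations are meet irreducible. -/

namespace AFSystem

variable {𝔄 : Type*} [NonUnitalCStarAlgebra 𝔄] {M : AFSystem 𝔄} {A : NonUnitalSubalgebra ℂ 𝔄}

/-- Every corner of `a` is a multiple of a matrix unit, and this unit lies in `I` when the multiple
is nonzero; so only the units of `I` in the selected columns matter. -/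
theorem mul_sum_p_mem {I J : Submodule ℂ 𝔄}
    (hU : ∀ n, A.toSubmodule ⊓ M.level n = M.upper n) (hI : IsClosedIdeal A I) {m : ℕ}
    {F : Finset (M.Idx m)}
    (hF : ∀ x ∈ F, ∀ i, M.e m x.1 i x.2 ∈ I → M.e m x.1 i x.2 ∈ J) {a : 𝔄} (ha : a ∈ I)
    (hl : a ∈ M.level m) : a * ∑ x ∈ F, M.p m x ∈ J := by
  rw [Finset.mul_sum]
  refine Submodule.sum_mem _ fun x hx => ?_
  rw [← one_mul_of_mem hl, one, Finset.sum_mul, Finset.sum_mul]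
  refine Submodule.sum_mem _ fun z _ => ?_
  obtain ⟨t, k⟩ := x
  obtain ⟨t', i⟩ := z
  by_cases h : t' = t
  · subst h
    obtain ⟨c, hc⟩ := exists_corner hl t' i k
    have hc' : M.p m ⟨t', i⟩ * a * M.p m ⟨t', k⟩ = c • M.e m t' i k := hc
    rw [hc']
    rcases eq_or_ne c 0 with rfl | h0
    · simp
    · refine J.smul_mem _ (hF _ hx i ?_)
      have : c • M.e m t' i k ∈ I := by
        rw [← hc']
        exact hI.mul_right _ (p_mem hU _ _) _ (hI.mul_left _ (p_mem hU _ _) _ ha)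
      have h2 := I.smul_mem c⁻¹ this
      rwa [smul_smul, inv_mul_cancel₀ h0, one_smul] at h2
  · rw [corner_of_ne hl (by exact h)]; simp

/-- In each column of `𝔄ₘ`, one of two ideals adds nothing to their intersection. -/
theorem column_dichotomy (hU : ∀ n, A.toSubmodule ⊓ M.level n = M.upper n)
    {I₁ I₂ J : Submodule ℂ 𝔄} (h₁ : IsClosedIdeal A I₁) (h₂ : IsClosedIdeal A I₂)
    (hJ : I₁ ⊓ I₂ ≤ J) {m : ℕ} {x : M.Idx m} {i₀ : Fin (M.size m x.1)}
    (hi₀ : M.e m x.1 i₀ x.2 ∈ I₁) (hi₀' : M.e m x.1 i₀ x.2 ∉ J) (i : Fin (M.size m x.1))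
    (hi : M.e m x.1 i x.2 ∈ I₂) : M.e m x.1 i x.2 ∈ J := by
  -- Left multiplication by an upper triangular unit moves a unit up its column, so whichever of the
  -- two positions is higher belongs to both ideals.
  rcases le_total i i₀ with h | h
  · refine hJ ⟨?_, hi⟩
    have := h₁.mul_left _ (e_mem hU h) _ hi₀
    rwa [M.e_mul_e, if_pos rfl] at this
  · refine absurd (hJ ⟨hi₀, ?_⟩) hi₀'
    have := h₂.mul_left _ (e_mem hU h) _ hi
    rwa [M.e_mul_e, if_pos rfl] at this

end AFSystem

section NestRep

open AFSystem

variable {𝔄 : Type*} [NonUnitalCStarAlgebra 𝔄] {M : AFSystem 𝔄} {A : NonUnitalSubalgebra ℂ 𝔄}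
  {H : Type*} [NormedAddCommGroup H] [InnerProductSpace ℂ H] {π : A →ₙₐ[ℂ] (H →L[ℂ] H)}

theorem IsBoundedNestRep.continuous (hπ : IsBoundedNestRep π) : Continuous π := by
  obtain ⟨C, hC⟩ := hπ.bounded
  exact (((π : A →ₗ[ℂ] (H →L[ℂ] H))).mkContinuous C hC).continuous

/-- The vectors annihilated by an ideal. -/
def annihilated (π : A →ₙₐ[ℂ] (H →L[ℂ] H)) (I : Submodule ℂ 𝔄) : Submodule ℂ H where
  carrier := {h | ∀ a : A, (a : 𝔄) ∈ I → π a h = 0}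
  zero_mem' := fun a _ => map_zero _
  add_mem' := fun {x y} hx hy a ha => by rw [map_add, hx a ha, hy a ha, add_zero]
  smul_mem' := fun c x hx a ha => by rw [map_smul, hx a ha, smul_zero]

theorem isClosed_annihilated (I : Submodule ℂ 𝔄) : IsClosed (annihilated π I : Set H) := by
  have : (annihilated π I : Set H) = ⋂ a : A, ⋂ _ : (a : 𝔄) ∈ I, {h | π a h = 0} := by
    ext h; simp [annihilated]
  rw [this]
  exact isClosed_iInter fun a => isClosed_iInter fun _ =>
    isClosed_eq (π a).continuous continuous_const

theorem map_mem_annihilated {I : Submodule ℂ 𝔄} (hI : IsClosedIdeal A I) (a : A) (h : H)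
    (hh : h ∈ annihilated π I) : π a h ∈ annihilated π I := fun b hb => by
  have := hh (b * a) (hI.mul_right a a.2 b hb)
  rwa [map_mul] at this

/-- The elements of `A` annihilating a vector. -/
noncomputable def annihilator (π : A →ₙₐ[ℂ] (H →L[ℂ] H)) (z : H) : Submodule ℂ 𝔄 :=
  (LinearMap.ker ((ContinuousLinearMap.apply ℂ H z).toLinearMap ∘ₗ
    (π : A →ₗ[ℂ] (H →L[ℂ] H)))).map A.toSubmodule.subtype

theorem mem_annihilator {z : H} {a : A} : (a : 𝔄) ∈ annihilator π z ↔ π a z = 0 := by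
  constructor
  · rintro ⟨b, hb, hba⟩
    obtain rfl : b = a := Subtype.ext hba
    exact hb
  · exact fun h => ⟨a, h, rfl⟩

theorem isClosed_annihilator (hA : IsTAF M A) (hπ : IsBoundedNestRep π) (z : H) :
    IsClosed (annihilator π z : Set 𝔄) := by
  refine hA.isClosed.isClosedEmbedding_subtypeVal.isClosedMap {a : A | π a z = 0} ?_
  exact isClosed_eq (((ContinuousLinearMap.apply ℂ H z).continuous).comp hπ.continuous)
    continuous_const

/-- The `u m` act as asymptotic right projections that kill `I₁` and fix `I₂` modulo the kernel. For
each vector `h`, a weak limit of `π (u m) h` is annihilated by `I₁`, hence by `I₂`, yet on `I₂` it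
acts like `h`. -/
theorem map_eq_zero_of_annihilated_le [CompleteSpace H] (hA : IsTAF M A)
    (hU : ∀ n, A.toSubmodule ⊓ M.level n = M.upper n) (hπ : IsBoundedNestRep π)
    {I₁ I₂ : Submodule ℂ 𝔄} (h₁ : IsClosedIdeal A I₁) (h₂ : IsClosedIdeal A I₂)
    (hN : annihilated π I₁ ≤ annihilated π I₂) (u : ℕ → A) (hu : ∀ m, ‖(u m : 𝔄)‖ ≤ 1)
    (hu₁ : ∀ n m, n ≤ m → ∀ a : A, (a : 𝔄) ∈ I₁ → (a : 𝔄) ∈ M.level n → π (a * u m) = 0)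
    (hu₂ : ∀ n m, n ≤ m → ∀ a : A, (a : 𝔄) ∈ I₂ → (a : 𝔄) ∈ M.level n → π (a * u m) = π a)
    (a : A) (ha : (a : 𝔄) ∈ I₂) : π a = 0 := by
  ext h
  obtain ⟨C, hC⟩ := hπ.bounded
  obtain ⟨z, hz⟩ := exists_weak_limit (fun m => π (u m) h) (C := |C| * ‖h‖) fun m => by
    refine ((π (u m)).le_opNorm h).trans ?_
    gcongr
    refine (hC _).trans ?_
    nlinarith [le_abs_self C, abs_nonneg C, norm_nonneg (u m : 𝔄), hu m]
  -- Weak convergence survives the bounded operator `π b`, by moving it to its adjoint.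
  have key : ∀ (b : A) (v : H), Tendsto (fun m => ⟪v, π (b * u m) h⟫_ℂ) (hyperfilter ℕ)
      (𝓝 ⟪v, π b z⟫_ℂ) := fun b v => by
    have := hz ((π b).adjoint v)
    simp only [ContinuousLinearMap.adjoint_inner_left] at this
    simpa only [map_mul, mul_apply_eq_comp] using this
  have hev : ∀ n : ℕ, ∀ᶠ m in (hyperfilter ℕ : Filter ℕ), n ≤ m := fun n =>
    Nat.hyperfilter_le_atTop (eventually_ge_atTop n)
  have hz₁ : z ∈ annihilated π I₁ := by
    intro b hb
    have : I₁ ≤ annihilator π z := by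
      refine le_of_e_mem hA hU h₁ (isClosed_annihilator hA hπ z) fun n r i j he => ?_
      let e : A := ⟨M.e n r i j, h₁.le he⟩
      refine mem_annihilator (a := e).2 (ext_inner_left ℂ fun v => ?_)
      refine tendsto_nhds_unique (key e v) (tendsto_const_nhds.congr' ?_)
      filter_upwards [hev n] with m hm
      rw [hu₁ n m hm e he (e_mem_level _ _ _ _)]; simp
    exact mem_annihilator.1 (this hb)
  have hz₂ := hN hz₁
  have : I₂ ≤ annihilator π h := by
    refine le_of_e_mem hA hU h₂ (isClosed_annihilator hA hπ h) fun n r i j he => ?_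
    let e : A := ⟨M.e n r i j, h₂.le he⟩
    refine mem_annihilator (a := e).2 (ext_inner_left ℂ fun v => ?_)
    have h3 := key e v
    rw [hz₂ e he] at h3
    refine tendsto_nhds_unique (tendsto_const_nhds.congr' ?_) h3
    filter_upwards [hev n] with m hm
    rw [hu₂ n m hm e he (e_mem_level _ _ _ _)]
  exact mem_annihilator.1 (this ha)

/-- If two closed ideals intersect in the kernel of a bounded nest representation, then one of
them is contained in the kernel. -/
theorem IsBoundedNestRep.map_eq_zero_or [CompleteSpace H] (hA : IsTAF M A)
    (hU : ∀ n, A.toSubmodule ⊓ M.level n = M.upper n) (hπ : IsBoundedNestRep π)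
    {I₁ I₂ J : Submodule ℂ 𝔄} (h₁ : IsClosedIdeal A I₁) (h₂ : IsClosedIdeal A I₂)
    (hJ : ∀ a : A, (a : 𝔄) ∈ J ↔ π a = 0) (hI : I₁ ⊓ I₂ ≤ J) : I₁ ≤ J ∨ I₂ ≤ J := by
  classical
  -- `S m` collects the columns in which `I₁` has no unit outside `J`; in the complementary columns
  -- `I₂` has none.
  let S : (m : ℕ) → Finset (M.Idx m) := fun m =>
    Finset.univ.filter fun x => ∀ i, M.e m x.1 i x.2 ∈ I₁ → M.e m x.1 i x.2 ∈ J
  have hS₁ : ∀ m, ∀ x ∈ S m, ∀ i, M.e m x.1 i x.2 ∈ I₁ → M.e m x.1 i x.2 ∈ J :=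
    fun m x hx => (Finset.mem_filter.1 hx).2
  have hS₂ : ∀ m, ∀ x ∈ (S m)ᶜ, ∀ i, M.e m x.1 i x.2 ∈ I₂ → M.e m x.1 i x.2 ∈ J := by
    intro m x hx i hi
    have : ¬ ∀ i, M.e m x.1 i x.2 ∈ I₁ → M.e m x.1 i x.2 ∈ J := fun h =>
      Finset.mem_compl.1 hx (Finset.mem_filter.2 ⟨Finset.mem_univ _, h⟩)
    push Not at this
    obtain ⟨i₀, h, h'⟩ := this
    exact column_dichotomy hU h₁ h₂ hI h h' i hi
  let u : (m : ℕ) → Finset (M.Idx m) → A := fun m F =>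
    ⟨∑ x ∈ F, M.p m x, sum_mem fun x _ => p_mem hU m x⟩
  have hu : ∀ m F, ‖(u m F : 𝔄)‖ ≤ 1 := fun m F => norm_sum_p_le m F
  have hkill : ∀ {I : Submodule ℂ 𝔄}, IsClosedIdeal A I → ∀ F : (m : ℕ) → Finset (M.Idx m),
      (∀ m, ∀ x ∈ F m, ∀ i, M.e m x.1 i x.2 ∈ I → M.e m x.1 i x.2 ∈ J) → ∀ n m, n ≤ m →
      ∀ a : A, (a : 𝔄) ∈ I → (a : 𝔄) ∈ M.level n → π (a * u m (F m)) = 0 :=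
    fun hI F hF n m hnm a ha hl => (hJ _).1 (mul_sum_p_mem hU hI (hF m) ha (level_mono hnm hl))
  have hadd : ∀ m F, ∀ a : A, (a : 𝔄) ∈ M.level m →
      π (a * u m F) + π (a * u m Fᶜ) = π a := fun m F a hl => by
    rw [← map_add]
    congr 1
    refine Subtype.ext ?_
    change (a : 𝔄) * ∑ x ∈ F, M.p m x + (a : 𝔄) * ∑ x ∈ Fᶜ, M.p m x = a
    rw [← mul_add, Finset.sum_add_sum_compl]
    exact mul_one_of_mem hl
  have hle : ∀ {I : Submodule ℂ 𝔄}, IsClosedIdeal A I →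
      (∀ a : A, (a : 𝔄) ∈ I → π a = 0) → I ≤ J := fun hI h a ha =>
    (hJ ⟨a, hI.le ha⟩).2 (h ⟨a, hI.le ha⟩ ha)
  rcases hπ.nest (annihilated π I₁) (annihilated π I₂) (isClosed_annihilated _)
    (isClosed_annihilated _) (map_mem_annihilated h₁) (map_mem_annihilated h₂) with hN | hN
  · right
    refine hle h₂ (map_eq_zero_of_annihilated_le hA hU hπ h₁ h₂ hN (fun m => u m (S m))
      (fun m => hu m _) (hkill h₁ S hS₁) fun n m hnm a ha hl => ?_)
    rw [← hadd m (S m) a (level_mono hnm hl),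
      hkill h₂ (fun m => (S m)ᶜ) hS₂ n m hnm a ha hl, add_zero]
  · left
    refine hle h₁ (map_eq_zero_of_annihilated_le hA hU hπ h₂ h₁ hN (fun m => u m (S m)ᶜ)
      (fun m => hu m _) (hkill h₂ (fun m => (S m)ᶜ) hS₂) fun n m hnm a ha hl => ?_)
    rw [← hadd m (S m) a (level_mono hnm hl), hkill h₁ S hS₁ n m hnm a ha hl, zero_add]

theorem IsBoundedNestRep.isClosed_ker (hπ : IsBoundedNestRep π) :
    IsClosed (TwoSidedIdeal.ker π : Set A) := by
  have : (TwoSidedIdeal.ker π : Set A) = π ⁻¹' {0} := by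
    ext a; exact TwoSidedIdeal.mem_ker π
  rw [this]
  exact isClosed_singleton.preimage hπ.continuous

/-- The kernel of a bounded nest representation is meet irreducible. -/
theorem IsBoundedNestRep.isMeetIrreducible_ker [CompleteSpace H] (hA : IsTAF M A)
    (hU : ∀ n, A.toSubmodule ⊓ M.level n = M.upper n) (hπ : IsBoundedNestRep π) :
    IsMeetIrreducible (TwoSidedIdeal.ker π) := by
  refine ⟨hπ.isClosed_ker, fun I₁ I₂ hc₁ hc₂ hle₁ hle₂ hI => ?_⟩
  obtain ⟨J, hJ, hJm⟩ := exists_isClosedIdeal hA hU hπ.isClosed_ker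
  obtain ⟨K₁, hK₁, hm₁⟩ := exists_isClosedIdeal hA hU hc₁
  obtain ⟨K₂, hK₂, hm₂⟩ := exists_isClosedIdeal hA hU hc₂
  have hKJ : K₁ ⊓ K₂ ≤ J := by
    rintro a ⟨ha₁, ha₂⟩
    refine (hJm ⟨a, hK₁.le ha₁⟩).2 ?_
    rw [← hI]
    exact (TwoSidedIdeal.mem_inf A).2 ⟨(hm₁ _).1 ha₁, (hm₂ _).1 ha₂⟩
  rcases hπ.map_eq_zero_or hA hU hK₁ hK₂ (fun a => (hJm a).trans (TwoSidedIdeal.mem_ker π)) hKJ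
    with h | h
  · left
    exact le_antisymm (fun a ha => (hJm a).1 (h ((hm₁ a).2 ha))) hle₁
  · right
    exact le_antisymm (fun a ha => (hJm a).1 (h ((hm₂ a).2 ha))) hle₂

end NestRep

/-! ### Ideals generated by one unit, and the directedness forced by meet irreducibility. -/

namespace AFSystem

variable {𝔄 : Type*} [NonUnitalCStarAlgebra 𝔄] {M : AFSystem 𝔄} {A : NonUnitalSubalgebra ℂ 𝔄}

/-- The closed ideal of `A` generated by `J` and the element `f`. -/
def adjoinIdeal (A : NonUnitalSubalgebra ℂ 𝔄) (J : Submodule ℂ 𝔄) (f : 𝔄) : Submodule ℂ 𝔄 :=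
  (J ⊔ Submodule.span ℂ {x | ∃ a ∈ A, ∃ b ∈ A, x = a * f * b}).topologicalClosure

theorem isClosedIdeal_adjoinIdeal (hA : IsTAF M A) {J : Submodule ℂ 𝔄} (hJ : IsClosedIdeal A J)
    {f : 𝔄} (hf : f ∈ A) : IsClosedIdeal A (adjoinIdeal A J f) where
  le := by
    refine Submodule.topologicalClosure_minimal _ (sup_le hJ.le (Submodule.span_le.2 ?_))
      hA.isClosed
    rintro _ ⟨a, ha, b, hb, rfl⟩
    exact A.mul_mem (A.mul_mem ha hf) hb
  isClosed := Submodule.isClosed_topologicalClosure _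
  mul_left := by
    intro c hc x hx
    have hspan : Submodule.span ℂ {x | ∃ a ∈ A, ∃ b ∈ A, x = a * f * b} ≤
        (Submodule.span ℂ {x | ∃ a ∈ A, ∃ b ∈ A, x = a * f * b}).comap (LinearMap.mulLeft ℂ c) := by
      refine Submodule.span_le.2 ?_
      rintro _ ⟨a, ha, b, hb, rfl⟩
      exact Submodule.subset_span ⟨c * a, mul_mem hc ha, b, hb, by simp [mul_assoc]⟩
    refine map_mem_closure (f := fun x => c * x) (continuous_const_mul c) hx fun y hy => ?_
    obtain ⟨j, hj, z, hz, rfl⟩ := Submodule.mem_sup.1 hy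
    change c * (j + z) ∈ _
    rw [mul_add]
    exact Submodule.add_mem_sup (hJ.mul_left c hc j hj) (hspan hz)
  mul_right := by
    intro c hc x hx
    have hspan : Submodule.span ℂ {x | ∃ a ∈ A, ∃ b ∈ A, x = a * f * b} ≤
        (Submodule.span ℂ {x | ∃ a ∈ A, ∃ b ∈ A, x = a * f * b}).comap
          (LinearMap.mulRight ℂ c) := by
      refine Submodule.span_le.2 ?_
      rintro _ ⟨a, ha, b, hb, rfl⟩
      exact Submodule.subset_span ⟨a, ha, b * c, mul_mem hb hc, by simp [mul_assoc]⟩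
    refine map_mem_closure (f := fun x => x * c) (continuous_mul_const c) hx fun y hy => ?_
    obtain ⟨j, hj, z, hz, rfl⟩ := Submodule.mem_sup.1 hy
    change (j + z) * c ∈ _
    rw [add_mul]
    exact Submodule.add_mem_sup (hJ.mul_right c hc j hj) (hspan hz)

theorem le_adjoinIdeal (J : Submodule ℂ 𝔄) (f : 𝔄) : J ≤ adjoinIdeal A J f :=
  le_sup_left.trans (Submodule.le_topologicalClosure _)

/-- The generators are only two-sided products; `f` is one of them because the identity of `𝔄ₙ` is a
local unit for it. -/
theorem mem_adjoinIdeal (hU : ∀ n, A.toSubmodule ⊓ M.level n = M.upper n) (J : Submodule ℂ 𝔄)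
    {n : ℕ} {f : 𝔄} (hf : f ∈ M.level n) : f ∈ adjoinIdeal A J f := by
  refine Submodule.le_topologicalClosure _ (Submodule.mem_sup_right (Submodule.subset_span
    ⟨M.one n, one_mem hU n, M.one n, one_mem hU n, ?_⟩))
  rw [one_mul_of_mem hf, mul_one_of_mem hf]

/-- A closed subspace containing all triangular algebras contains `A`. -/
theorem le_of_upper_le (hA : IsTAF M A) (hU : ∀ n, A.toSubmodule ⊓ M.level n = M.upper n)
    {S : Submodule ℂ 𝔄} (hS : IsClosed (S : Set 𝔄)) (h : ∀ n, M.upper n ≤ S) :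
    A.toSubmodule ≤ S := by
  intro a ha
  refine closure_minimal (Set.iUnion_subset fun n => ?_) hS (hA.limit ha)
  rintro x ⟨hx, hx'⟩
  exact h n (mem_upper_of_mem hU hx hx')

theorem upper_mono (hU : ∀ n, A.toSubmodule ⊓ M.level n = M.upper n) : Monotone M.upper :=
  fun n m hnm => by
    rw [← hU n, ← hU m]; exact inf_le_inf_left _ (level_mono hnm)

/-- The span of the products `a * f * b` with `a` and `b` in the triangular algebra of `𝔄ₘ`. -/
def upperSandwich (M : AFSystem 𝔄) (f : 𝔄) (m : ℕ) : Submodule ℂ 𝔄 :=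
  Submodule.span ℂ {x | ∃ a ∈ M.upper m, ∃ b ∈ M.upper m, x = a * f * b}

theorem upperSandwich_mono (hU : ∀ n, A.toSubmodule ⊓ M.level n = M.upper n) (f : 𝔄) :
    Monotone (M.upperSandwich f) := fun n m hnm => Submodule.span_mono <| by
  rintro _ ⟨a, ha, b, hb, rfl⟩
  exact ⟨a, upper_mono hU hnm ha, b, upper_mono hU hnm hb, rfl⟩

/-- Density is used in one factor at a time: `b` stays in a finite level while `a` is approximated,
and then `b` is approximated. -/
theorem mul_mul_mem_closure (hA : IsTAF M A)
    (hU : ∀ n, A.toSubmodule ⊓ M.level n = M.upper n) (f : 𝔄) {a b : 𝔄} (ha : a ∈ A)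
    (hb : b ∈ A) : a * f * b ∈ (⨆ m, M.upperSandwich f m).topologicalClosure := by
  set S := (⨆ m, M.upperSandwich f m).topologicalClosure with hSdef
  have hS : IsClosed (S : Set 𝔄) := Submodule.isClosed_topologicalClosure _
  have h1 : ∀ n, ∀ b ∈ M.upper n, ∀ a ∈ A, a * f * b ∈ S := by
    intro n b hb
    have : A.toSubmodule ≤ S.comap (LinearMap.mulRight ℂ b ∘ₗ LinearMap.mulRight ℂ f) := by
      refine le_of_upper_le hA hU ?_ fun m a ha => ?_
      · exact hS.preimage ((continuous_mul_const b).comp (continuous_mul_const f))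
      · refine Submodule.le_topologicalClosure _ (Submodule.mem_iSup_of_mem (max n m) ?_)
        exact Submodule.subset_span ⟨a, upper_mono hU (le_max_right _ _) ha, b,
          upper_mono hU (le_max_left _ _) hb, rfl⟩
    exact fun a ha => this ha
  have : A.toSubmodule ≤ S.comap (LinearMap.mulLeft ℂ (a * f)) := by
    refine le_of_upper_le hA hU ?_ fun m b hb => h1 m b hb a ha
    exact hS.preimage (continuous_const_mul (a * f))
  exact this hb

theorem exists_mem_level_of_mem_unitSpan {J : Submodule ℂ 𝔄} {x : 𝔄} (hx : x ∈ M.unitSpan J) :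
    x ∈ J ∧ ∃ n, x ∈ M.level n := by
  induction hx using Submodule.span_induction with
  | mem x h =>
    obtain ⟨h, n, r, i, j, rfl⟩ := h
    exact ⟨h, n, e_mem_level _ _ _ _⟩
  | zero => exact ⟨zero_mem _, 0, zero_mem _⟩
  | add x y _ _ hx hy =>
    obtain ⟨h, n, hn⟩ := hx
    obtain ⟨h', m, hm⟩ := hy
    exact ⟨add_mem h h', max n m, add_mem (level_mono (le_max_left _ _) hn)
      (level_mono (le_max_right _ _) hm)⟩
  | smul c x _ hx => exact ⟨J.smul_mem c hx.1, hx.2.imp fun n hn => Submodule.smul_mem _ c hn⟩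

/-- If an element of the closed ideal generated by `J` and `f` has an entry one outside `J` deep
enough, then `f` has a nonzero entry to the south-west of it. -/
theorem exists_corner_ne_zero_of_mem_adjoinIdeal (hA : IsTAF M A)
    (hU : ∀ n, A.toSubmodule ⊓ M.level n = M.upper n) {J : Submodule ℂ 𝔄}
    (hJ : IsClosedIdeal A J) {f h : 𝔄} (hh : h ∈ adjoinIdeal A J f) :
    ∃ m₀, ∀ m, m₀ ≤ m → ∀ (t : Fin (M.blocks m)) (k l : Fin (M.size m t)), M.e m t k l ∉ J →
      M.e m t k k * h * M.e m t l l = M.e m t k l →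
      ∃ u v, k ≤ u ∧ v ≤ l ∧ M.e m t u u * f * M.e m t v v ≠ 0 := by
  have h1 : adjoinIdeal A J f ≤
      (M.unitSpan J ⊔ ⨆ m, M.upperSandwich f m).topologicalClosure := by
    refine Submodule.topologicalClosure_minimal _ (sup_le ?_ (Submodule.span_le.2 ?_))
      (Submodule.isClosed_topologicalClosure _)
    · exact (le_closure_unitSpan hA hU hJ).trans (Submodule.topologicalClosure_mono le_sup_left)
    · rintro _ ⟨a, ha, b, hb, rfl⟩
      exact Submodule.topologicalClosure_mono le_sup_right (mul_mul_mem_closure hA hU f ha hb)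
  -- Distance below `1` suffices: the corner of `h` is a matrix unit of norm `1` and the part in `J`
  -- has zero corner there, so the part generated by `f` cannot.
  obtain ⟨x, hx, hd⟩ := Metric.mem_closure_iff.1 (h1 hh) 1 one_pos
  rw [dist_eq_norm] at hd
  obtain ⟨j, hj, y, hy, rfl⟩ := Submodule.mem_sup.1 hx
  obtain ⟨hjJ, n, hn⟩ := exists_mem_level_of_mem_unitSpan hj
  obtain ⟨n', hn'⟩ := (Submodule.mem_iSup_of_directed _
    (upperSandwich_mono hU f).directed_le).1 hy
  refine ⟨max n n', fun m hm t k l hkl hcorner => ?_⟩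
  have hjm := level_mono ((le_max_left _ _).trans hm) hn
  have hym := upperSandwich_mono hU f ((le_max_right _ _).trans hm) hn'
  have hj0 : M.e m t k k * j * M.e m t l l = 0 := by
    obtain ⟨c, hc⟩ := exists_corner hjm t k l
    rcases eq_or_ne c 0 with rfl | h0
    · simpa using hc
    · exfalso
      have : c • M.e m t k l ∈ J := by
        rw [← hc]
        exact hJ.mul_right _ (e_mem hU le_rfl) _ (hJ.mul_left _ (e_mem hU le_rfl) _ hjJ)
      have h2 := J.smul_mem c⁻¹ this
      rw [smul_smul, inv_mul_cancel₀ h0, one_smul] at h2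
      exact hkl h2
  have hy0 : M.e m t k k * y * M.e m t l l ≠ 0 := by
    intro h0
    have h2 : M.e m t k k * (h - (j + y)) * M.e m t l l = M.e m t k l := by
      simp only [mul_sub, sub_mul, mul_add, add_mul, hj0, h0, hcorner, add_zero, sub_zero]
    have h3 := congrArg norm h2
    rw [norm_e] at h3
    have h4 : ‖M.e m t k k * (h - (j + y)) * M.e m t l l‖ ≤ ‖h - (j + y)‖ := by
      refine (norm_mul_le _ _).trans ?_
      rw [norm_e, mul_one]
      refine (norm_mul_le _ _).trans ?_
      rw [norm_e, one_mul]
    linarith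
  obtain ⟨a, ha, b, hb, hab⟩ : ∃ a ∈ M.upper m, ∃ b ∈ M.upper m,
      M.e m t k k * (a * f * b) * M.e m t l l ≠ 0 := by
    by_contra hcon
    push Not at hcon
    refine hy0 ?_
    clear hy0 hy hn' hd hx
    induction hym using Submodule.span_induction with
    | mem x h => obtain ⟨a, ha, b, hb, rfl⟩ := h; exact hcon a ha b hb
    | zero => simp
    | add x y _ _ hx hy => rw [mul_add, add_mul, hx, hy, add_zero]
    | smul c x _ hx => rw [mul_smul_comm, smul_mul_assoc, hx, smul_zero]
  have hal : a ∈ M.level m := by rw [← hU] at ha; exact ha.2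
  have hbl : b ∈ M.level m := by rw [← hU] at hb; exact hb.2
  -- A nonzero term of this expansion gives an entry of `f` at `(u, v)`; triangularity of `a` and
  -- `b` yields `k ≤ u` and `v ≤ l`.
  have hexp : M.e m t k k * (a * f * b) * M.e m t l l = ∑ x : M.Idx m, ∑ z : M.Idx m,
      (M.p m ⟨t, k⟩ * a * M.p m x) * (M.p m x * f * M.p m z) *
        (M.p m z * b * M.p m ⟨t, l⟩) := by
    have e1 : ∀ x z : M.Idx m, (M.p m ⟨t, k⟩ * a * M.p m x) * (M.p m x * f * M.p m z) *
        (M.p m z * b * M.p m ⟨t, l⟩) =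
        M.p m ⟨t, k⟩ * a * M.p m x * f * (M.p m z * b * M.p m ⟨t, l⟩) := fun x z => by
      have e2 : ∀ c, M.p m x * (M.p m x * c) = M.p m x * c := fun c => by
        rw [← mul_assoc, p_mul_self]
      have e3 : ∀ c, M.p m z * (M.p m z * c) = M.p m z * c := fun c => by
        rw [← mul_assoc, p_mul_self]
      simp only [mul_assoc, e2, e3]
    simp only [e1]
    simp only [← Finset.mul_sum, ← Finset.sum_mul]
    change _ = M.p m ⟨t, k⟩ * a * M.one m * f * (M.one m * b * M.p m ⟨t, l⟩)
    rw [mul_assoc _ a, mul_one_of_mem hal, one_mul_of_mem hbl]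
    simp only [mul_assoc]
    rfl
  rw [hexp] at hab
  obtain ⟨x, -, hx⟩ := Finset.exists_ne_zero_of_sum_ne_zero hab
  obtain ⟨z, -, hz⟩ := Finset.exists_ne_zero_of_sum_ne_zero hx
  have hz1 : M.p m ⟨t, k⟩ * a * M.p m x ≠ 0 := fun h0 => hz (by rw [h0]; simp)
  have hz2 : M.p m x * f * M.p m z ≠ 0 := fun h0 => hz (by rw [h0]; simp)
  have hz3 : M.p m z * b * M.p m ⟨t, l⟩ ≠ 0 := fun h0 => hz (by rw [h0]; simp)
  obtain ⟨t₁, u⟩ := x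
  obtain ⟨t₂, v⟩ := z
  obtain rfl : t = t₁ := by
    by_contra h; exact hz1 (corner_of_ne hal h)
  obtain rfl : t₂ = t := by
    by_contra h; exact hz3 (corner_of_ne hbl h)
  refine ⟨u, v, ?_, ?_, hz2⟩
  · by_contra h; exact hz1 (corner_upper ha (not_le.1 h))
  · by_contra h; exact hz3 (corner_upper hb (not_le.1 h))

/-- Two matrix units outside a meet irreducible ideal dominate a common matrix unit outside it. -/
theorem exists_common_unit (hA : IsTAF M A) (hU : ∀ n, A.toSubmodule ⊓ M.level n = M.upper n)
    {J : Submodule ℂ 𝔄} (hJ : IsClosedIdeal A J)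
    (hmeet : ∀ I₁ I₂ : Submodule ℂ 𝔄, IsClosedIdeal A I₁ → IsClosedIdeal A I₂ → J ≤ I₁ → J ≤ I₂ →
      I₁ ⊓ I₂ = J → I₁ = J ∨ I₂ = J)
    {n n' : ℕ} {r : Fin (M.blocks n)} {i j : Fin (M.size n r)} {r' : Fin (M.blocks n')}
    {i' j' : Fin (M.size n' r')} (hij : i ≤ j) (hij' : i' ≤ j') (hf : M.e n r i j ∉ J)
    (hg : M.e n' r' i' j' ∉ J) (N : ℕ) :
    ∃ m, N ≤ m ∧ n ≤ m ∧ n' ≤ m ∧ ∃ (t : Fin (M.blocks m)) (k l : Fin (M.size m t)),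
      M.e m t k l ∉ J ∧
      (∃ u v, k ≤ u ∧ v ≤ l ∧ M.e m t u u * M.e n r i j * M.e m t v v = M.e m t u v) ∧
      (∃ u v, k ≤ u ∧ v ≤ l ∧ M.e m t u u * M.e n' r' i' j' * M.e m t v v = M.e m t u v) := by
  have hI₁ := isClosedIdeal_adjoinIdeal hA hJ (e_mem hU hij)
  have hI₂ := isClosedIdeal_adjoinIdeal hA hJ (e_mem hU hij')
  obtain ⟨n₀, r₀, i₀, j₀, h₀, h₀'⟩ : ∃ n₀ r₀ i₀ j₀, M.e n₀ r₀ i₀ j₀ ∈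
      adjoinIdeal A J (M.e n r i j) ⊓ adjoinIdeal A J (M.e n' r' i' j') ∧
      M.e n₀ r₀ i₀ j₀ ∉ J := by
    by_contra hcon
    push Not at hcon
    -- Otherwise the two generated ideals would intersect in `J`, and one of them would equal `J`
    -- although it contains its generating unit.
    have hle := le_of_e_mem hA hU (hI₁.inf hI₂) hJ.isClosed hcon
    rcases hmeet _ _ hI₁ hI₂ (le_adjoinIdeal _ _) (le_adjoinIdeal _ _)
      (le_antisymm hle (le_inf (le_adjoinIdeal _ _) (le_adjoinIdeal _ _))) with h | h
    · exact hf (h ▸ mem_adjoinIdeal hU J (e_mem_level n r i j))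
    · exact hg (h ▸ mem_adjoinIdeal hU J (e_mem_level n' r' i' j'))
  obtain ⟨m₁, hm₁⟩ := exists_corner_ne_zero_of_mem_adjoinIdeal hA hU hJ h₀.1
  obtain ⟨m₂, hm₂⟩ := exists_corner_ne_zero_of_mem_adjoinIdeal hA hU hJ h₀.2
  obtain ⟨m, hNm, hnm, hnm', h₀m, h₁m, h₂m⟩ :
      ∃ m, N ≤ m ∧ n ≤ m ∧ n' ≤ m ∧ n₀ ≤ m ∧ m₁ ≤ m ∧ m₂ ≤ m :=
    ⟨N + n + n' + n₀ + m₁ + m₂, by omega, by omega, by omega, by omega, by omega, by omega⟩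
  have hl := level_mono h₀m (e_mem_level (M := M) n₀ r₀ i₀ j₀)
  -- The unit found may live at too shallow a level; it is the sum of its corners in `𝔄ₘ`, so one of
  -- these is outside `J`.
  obtain ⟨⟨t, k⟩, ⟨t', l⟩, hx⟩ : ∃ x y : M.Idx m,
      M.p m x * M.e n₀ r₀ i₀ j₀ * M.p m y ∉ J := by
    by_contra hcon
    push Not at hcon
    refine h₀' ?_
    rw [eq_sum_corner hl]
    exact Submodule.sum_mem _ fun x _ => Submodule.sum_mem _ fun y _ => hcon x y
  obtain rfl : t = t' := by
    by_contra h
    rw [corner_of_ne hl (by exact h)] at hx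
    exact hx (zero_mem _)
  have hx' : M.e m t k k * M.e n₀ r₀ i₀ j₀ * M.e m t l l ∉ J := hx
  have hkl := (corner_e hU h₀m r₀ i₀ j₀ t k l).resolve_right fun h => hx' (by
    rw [h]; exact zero_mem _)
  rw [hkl] at hx'
  refine ⟨m, hNm, hnm, hnm', t, k, l, hx', ?_, ?_⟩
  · obtain ⟨u, v, hu, hv, h⟩ := hm₁ m h₁m t k l hx' hkl
    exact ⟨u, v, hu, hv, (corner_e hU hnm r i j t u v).resolve_right h⟩
  · obtain ⟨u, v, hu, hv, h⟩ := hm₂ m h₂m t k l hx' hkl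
    exact ⟨u, v, hu, hv, (corner_e hU hnm' r' i' j' t u v).resolve_right h⟩

/-! ### Cells: units with a marked diagonal position, and their refining sequences. -/

/-- A matrix unit of some `𝔄ₙ` together with a diagonal position between its row and column. -/
structure Cell (M : AFSystem 𝔄) where
  n : ℕ
  r : Fin (M.blocks n)
  i : Fin (M.size n r)
  j : Fin (M.size n r)
  x : Fin (M.size n r)
  i_le : i ≤ x
  le_j : x ≤ j

namespace Cell

/-- The matrix unit of a cell. -/
def unit (c : M.Cell) : 𝔄 := M.e c.n c.r c.i c.j

/-- The diagonal matrix unit of a cell. -/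
def q (c : M.Cell) : 𝔄 := M.p c.n ⟨c.r, c.x⟩

/-- The interval of diagonal positions of a cell. -/
def interval (c : M.Cell) : Set (Fin (M.size c.n c.r)) := Set.Icc c.i c.j

/-- The cell `c'` refines `c`: its diagonal matrix unit is smaller, and the interval of `c` embeds
into that of `c'`. -/
structure Refines (c' c : M.Cell) : Prop where
  le : c.n ≤ c'.n
  q_mul_q : c.q * c'.q = c'.q
  transfer : ∀ s ∈ c.interval, ∀ s', M.e c.n c.r s c.x * c'.q = M.e c'.n c'.r s' c'.x →
    s' ∈ c'.interval

end Cell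

theorem e_left_injective {n : ℕ} {r : Fin (M.blocks n)} {s t k : Fin (M.size n r)}
    (h : M.e n r s k = M.e n r t k) : s = t := by
  by_contra hst
  have h1 := congrArg (M.e n r s s * ·) h
  simp only [M.e_mul_e, if_true, if_neg hst] at h1
  exact M.e_ne_zero _ _ _ _ h1

/-- The entry `(u, v)` of the unit of `c` singles out one copy of its summand in `𝔄ₘ`. Transfer `τ`
along this copy is monotone with `τ i = u` and `τ j = v`, so it carries `[i, j]` into `[u, v]`,
hence into `[k, l]`; the new marked position is `τ x`. -/
theorem exists_refines (hA : IsTAF M A) (hU : ∀ n, A.toSubmodule ⊓ M.level n = M.upper n)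
    {J : Submodule ℂ 𝔄} (hJ : IsClosedIdeal A J)
    (hmeet : ∀ I₁ I₂ : Submodule ℂ 𝔄, IsClosedIdeal A I₁ → IsClosedIdeal A I₂ → J ≤ I₁ → J ≤ I₂ →
      I₁ ⊓ I₂ = J → I₁ = J ∨ I₂ = J)
    (c f : M.Cell) (hc : c.unit ∉ J) (hf : f.unit ∉ J) (N : ℕ) :
    ∃ c' : M.Cell, c'.unit ∉ J ∧ N ≤ c'.n ∧ c'.Refines c ∧ ∃ u v, c'.i ≤ u ∧ v ≤ c'.j ∧
      M.e c'.n c'.r u u * f.unit * M.e c'.n c'.r v v = M.e c'.n c'.r u v := by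
  obtain ⟨n, r, i, j, x, hix, hxj⟩ := c
  obtain ⟨m, hNm, -, hnm, t, k, l, hkl, hdf, u, v, hku, hvl, huv⟩ :=
    exists_common_unit hA hU hJ hmeet (f.i_le.trans f.le_j) (hix.trans hxj) hf hc N
  have hv : M.p n ⟨r, j⟩ * M.p m ⟨t, v⟩ = M.p m ⟨t, v⟩ := by
    refine (p_mul_p_level hU hnm _ _).resolve_right fun h0 => M.e_ne_zero m t u v ?_
    have h1 : M.e n r i j * M.e m t v v = 0 := by
      have : M.e n r i j * M.p n ⟨r, j⟩ = M.e n r i j := by rw [e_mul_p, if_pos rfl]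
      change _ * M.p m ⟨t, v⟩ = 0
      rw [← this, mul_assoc, h0, mul_zero]
    rw [← huv, mul_assoc, h1, mul_zero]
  have htr : ∀ s, ∃ s' : Fin (M.size m t), M.e n r s j * M.p m ⟨t, v⟩ = M.e m t s' v :=
    fun s => exists_transfer hU hnm hv s
  choose τ hτ using htr
  have hmono : ∀ s s', s ≤ s' → τ s ≤ τ s' := fun s s' h =>
    transfer_mono hU (y := ⟨t, v⟩) (hτ s) (hτ s') h
  have hτj : τ j = v := e_left_injective ((hτ j).symm.trans hv)
  have hτi : τ i = u := by
    by_contra hne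
    refine M.e_ne_zero m t u v ?_
    rw [← huv, mul_assoc]
    change M.e m t u u * (M.e n r i j * M.p m ⟨t, v⟩) = 0
    rw [hτ i, M.e_mul_e, if_neg (Ne.symm hne)]
  have hint : ∀ s, i ≤ s → s ≤ j → k ≤ τ s ∧ τ s ≤ l := fun s h1 h2 =>
    ⟨hku.trans (hτi ▸ hmono i s h1), (hmono s j h2).trans (hτj ▸ hvl)⟩
  have hq : M.p m ⟨t, τ x⟩ = M.e n r x j * M.p m ⟨t, v⟩ * M.e n r j x :=
    (transfer_mul (y := ⟨t, v⟩) (hτ x) (hτ x)).symm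
  refine ⟨⟨m, t, k, l, τ x, (hint x hix hxj).1, (hint x hix hxj).2⟩, hkl, hNm,
    ⟨hnm, ?_, ?_⟩, hdf⟩
  · change M.p n ⟨r, x⟩ * M.p m ⟨t, τ x⟩ = M.p m ⟨t, τ x⟩
    rw [hq, ← mul_assoc, ← mul_assoc, p_mul_e, if_pos rfl]
  · rintro s ⟨hs1, hs2⟩ s' hs'
    change M.e n r s x * M.p m ⟨t, τ x⟩ = M.e m t s' (τ x) at hs'
    rw [hq, ← mul_assoc, ← mul_assoc, M.e_mul_e, if_pos rfl,
      transfer_mul (y := ⟨t, v⟩) (hτ s) (hτ x)] at hs'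
    obtain rfl : τ s = s' := e_left_injective hs'
    exact hint s hs1 hs2

instance : Countable M.Cell := by
  let F : M.Cell → Σ n : ℕ, Σ r : Fin (M.blocks n),
      Fin (M.size n r) × Fin (M.size n r) × Fin (M.size n r) := fun c => ⟨c.n, c.r, c.i, c.j, c.x⟩
  refine Function.Injective.countable (f := F) ?_
  rintro ⟨n, r, i, j, x, _, _⟩ ⟨n', r', i', j', x', _, _⟩ h
  simp only [F, Sigma.mk.injEq] at h
  obtain ⟨rfl, h⟩ := h
  simp only [heq_eq_eq, Sigma.mk.injEq] at h
  obtain ⟨rfl, h⟩ := h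
  simp only [heq_eq_eq, Prod.mk.injEq] at h
  obtain ⟨rfl, rfl, rfl⟩ := h
  rfl

/-- A meet irreducible proper ideal is described by a refining sequence of cells. -/
theorem exists_cell_seq (hA : IsTAF M A) (hU : ∀ n, A.toSubmodule ⊓ M.level n = M.upper n)
    {J : Submodule ℂ 𝔄} (hJ : IsClosedIdeal A J)
    (hmeet : ∀ I₁ I₂ : Submodule ℂ 𝔄, IsClosedIdeal A I₁ → IsClosedIdeal A I₂ → J ≤ I₁ → J ≤ I₂ →
      I₁ ⊓ I₂ = J → I₁ = J ∨ I₂ = J)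
    (hne : ∃ c : M.Cell, c.unit ∉ J) :
    ∃ c : ℕ → M.Cell, (∀ k, (c k).unit ∉ J) ∧ (∀ k, k ≤ (c k).n) ∧
      (∀ k, (c (k + 1)).Refines (c k)) ∧
      ∀ f : M.Cell, f.unit ∉ J → ∃ k u v, (c k).i ≤ u ∧ v ≤ (c k).j ∧
        M.e (c k).n (c k).r u u * f.unit * M.e (c k).n (c k).r v v =
          M.e (c k).n (c k).r u v := by
  let T := {c : M.Cell // c.unit ∉ J}
  obtain ⟨c₀, hc₀⟩ := hne
  have : Nonempty T := ⟨⟨c₀, hc₀⟩⟩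
  obtain ⟨f, hf⟩ := exists_surjective_nat T
  -- The step from `k` to `k + 1` deals with the `k`-th unit of an enumeration of all cells outside
  -- `J`; this is why the witness below is `k + 1`.
  have hstep : ∀ (k : ℕ) (c : T), ∃ c' : T, k + 1 ≤ c'.1.n ∧ c'.1.Refines c.1 ∧
      ∃ u v, c'.1.i ≤ u ∧ v ≤ c'.1.j ∧
        M.e c'.1.n c'.1.r u u * (f k).1.unit * M.e c'.1.n c'.1.r v v = M.e c'.1.n c'.1.r u v :=
    fun k c => by
      obtain ⟨c', h, h1, h2, h3⟩ := exists_refines hA hU hJ hmeet c.1 (f k).1 c.2 (f k).2 (k + 1)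
      exact ⟨⟨c', h⟩, h1, h2, h3⟩
  choose nxt h1 h2 h3 using hstep
  let c : ℕ → T := fun k => Nat.rec ⟨c₀, hc₀⟩ nxt k
  refine ⟨fun k => (c k).1, fun k => (c k).2, fun k => ?_, fun k => h2 k (c k), fun g hg => ?_⟩
  · cases k with
    | zero => exact Nat.zero_le _
    | succ k => exact h1 k (c k)
  · obtain ⟨k, hk⟩ := hf ⟨g, hg⟩
    have := h3 k (c k)
    rw [hk] at this
    exact ⟨k + 1, this⟩

end AFSystem

/-! ### A GNS vector fixed by a decreasing sequence of projections. -/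

open scoped ComplexOrder in
/-- A decreasing sequence of projections that are eventually minimal for a dense set of elements
has a common unit eigenvector in some representation. -/
theorem exists_rep_of_decreasing {𝔄 : Type u} [NonUnitalCStarAlgebra 𝔄] (q : ℕ → 𝔄)
    (hs : ∀ k, star (q k) = q k) (hp : ∀ k, q k * q k = q k) (h0 : ∀ k, q k ≠ 0)
    (hdec : ∀ k m, k ≤ m → q k * q m = q m) {D : Set 𝔄} (hD : Dense D)
    (hmin : ∀ a ∈ D, ∀ᶠ k in atTop, ∃ c : ℂ, q k * (star a * a) * q k = c • q k) :
    ∃ (K : Type u) (_ : NormedAddCommGroup K) (_ : InnerProductSpace ℂ K) (_ : CompleteSpace K)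
      (π : 𝔄 →⋆ₙₐ[ℂ] (K →L[ℂ] K)) (ξ : K), ‖ξ‖ = 1 ∧ ∀ k, π (q k) ξ = ξ := by
  let _ := CStarAlgebra.spectralOrder 𝔄
  have _ := CStarAlgebra.spectralOrderedRing 𝔄
  have hdec' : ∀ k m, k ≤ m → q m * q k = q m := fun k m h => by
    simpa [hs] using congrArg star (hdec k m h)
  have hq1 : ∀ k, ‖q k‖ = 1 := fun k => by
    have h := CStarRing.norm_star_mul_self (x := q k)
    rw [hs, hp] at h
    have := norm_ne_zero_iff.2 (h0 k)
    field_simp at h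
    exact h.symm
  -- Arbitrary norming functionals suffice, since positivity is only needed in the limit and is
  -- obtained there from `hmin`.
  have hdual : ∀ k, ∃ ψ : StrongDual ℂ 𝔄, ‖ψ‖ ≤ 1 ∧ ψ (q k) = 1 := fun k => by
    obtain ⟨ψ, h1, h2⟩ := exists_dual_vector ℂ (q k) (norm_ne_zero_iff.2 (h0 k))
    exact ⟨ψ, h1.le, by rw [h2, hq1]; simp⟩
  choose ψ hψ1 hψq using hdual
  have hψn : ∀ k a, ‖ψ k (q k * a * q k)‖ ≤ ‖a‖ := fun k a => by
    calc _ ≤ ‖ψ k‖ * (‖q k‖ * ‖a‖ * ‖q k‖) := ((ψ k).le_opNorm _).trans (by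
          gcongr; exact (norm_mul_le _ _).trans (by gcongr; exact norm_mul_le _ _))
      _ ≤ 1 * (‖q k‖ * ‖a‖ * ‖q k‖) := by gcongr; exact hψ1 k
      _ = ‖a‖ := by rw [hq1]; ring
  have hlim : ∀ a : 𝔄, ∃ c : ℂ, ‖c‖ ≤ 1 * ‖a‖ ∧
      Tendsto (fun k => ψ k (q k * a * q k)) (hyperfilter ℕ) (𝓝 c) := fun a => by
    obtain ⟨c, hc, hl⟩ := (isCompact_closedBall (0 : ℂ) (1 * ‖a‖)).ultrafilter_le_nhds
      ((hyperfilter ℕ).map fun k => ψ k (q k * a * q k)) (by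
        rw [le_principal_iff]
        refine Filter.mem_map.2 (Eventually.of_forall fun k => ?_)
        rw [mem_closedBall_zero_iff, one_mul]
        exact hψn k a)
    exact ⟨c, by simpa using hc, hl⟩
  choose φ hφ hl using hlim
  let L : 𝔄 →ₗ[ℂ] ℂ :=
    { toFun := φ
      map_add' := fun v w => by
        refine tendsto_nhds_unique (hl (v + w)) ?_
        simpa only [mul_add, add_mul, map_add] using (hl v).add (hl w)
      map_smul' := fun c v => by
        refine tendsto_nhds_unique (hl (c • v)) ?_
        simpa only [mul_smul_comm, smul_mul_assoc, map_smul, RingHom.id_apply] using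
          (hl v).const_smul c }
  have hLc : Continuous L := (L.mkContinuous 1 hφ).continuous
  have hφq : ∀ k, φ (q k) = 1 := fun k => by
    refine tendsto_nhds_unique (hl (q k)) (tendsto_const_nhds.congr' ?_)
    filter_upwards [Nat.hyperfilter_le_atTop (eventually_ge_atTop k)] with m hm
    rw [hdec' k m hm, hp, hψq]
  have hpos : ∀ a, 0 ≤ L (star a * a) := by
    have hcl : IsClosed {a : 𝔄 | 0 ≤ L (star a * a)} :=
      isClosed_le continuous_const (hLc.comp (continuous_star.mul continuous_id))
    -- For `a ∈ D` the compression of `star a * a` is eventually `c • q k`, and positivity of this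
    -- element forces `c` to be real and nonnegative.
    have hsub : D ⊆ {a : 𝔄 | 0 ≤ L (star a * a)} := by
      intro a ha
      refine ge_of_tendsto (hl (star a * a)) ?_
      filter_upwards [Nat.hyperfilter_le_atTop (hmin a ha)] with k hk
      obtain ⟨c, hc⟩ := hk
      rw [hc, map_smul, hψq, smul_eq_mul, mul_one]
      have hnn : 0 ≤ c • q k := by
        have := star_mul_self_nonneg (a * q k)
        rwa [star_mul, hs, mul_assoc, ← mul_assoc (star a), ← mul_assoc, hc] at this
      have hqnn : 0 ≤ q k := by
        have := star_mul_self_nonneg (q k)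
        rwa [hs, hp] at this
      have hinj := smul_left_injective ℂ (h0 k)
      have hreal : star c = c := by
        have := (IsSelfAdjoint.of_nonneg hnn).star_eq
        rw [star_smul, hs] at this
        exact hinj this
      have hre : ((c.re : ℝ) : ℂ) = c := Complex.conj_eq_iff_re.1 hreal
      rw [← hre] at hnn ⊢
      rw [Complex.zero_le_real]
      by_contra hneg
      push Not at hneg
      have h1 : 0 ≤ (-c.re) • q k := smul_nonneg (by linarith) hqnn
      rw [neg_smul, Left.nonneg_neg_iff] at h1
      rw [Complex.coe_smul] at hnn
      have h2 := le_antisymm h1 hnn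
      rcases smul_eq_zero.1 h2 with h | h
      · exact hneg.ne h
      · exact h0 k h
    exact fun a => hcl.closure_subset_iff.2 hsub (hD a)
  let f : 𝔄 →ₚ[ℂ] ℂ := PositiveLinearMap.mk₀ L fun a ha => by
    obtain ⟨b, rfl⟩ := CStarAlgebra.nonneg_iff_eq_star_mul_self.1 ha
    exact hpos b
  have hf : ∀ a, f a = φ a := fun _ => rfl
  -- The class of `q 0` replaces that of a unit. It is fixed by `q k` because the functional is `1`
  -- on both projections and hence vanishes on `q 0 - q k`.
  refine ⟨f.GNS, inferInstance, inferInstance, inferInstance, f.gnsNonUnitalStarAlgHom,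
    ((f.toPreGNS (q 0) : f.PreGNS) : f.GNS), ?_, fun k => ?_⟩
  · rw [UniformSpace.Completion.norm_coe, f.preGNS_norm_def, f.ofPreGNS_toPreGNS, hs, hp, hf, hφq]
    simp
  · rw [PositiveLinearMap.gnsNonUnitalStarAlgHom_apply_coe, ← sub_eq_zero,
      ← UniformSpace.Completion.coe_sub, ← norm_eq_zero, UniformSpace.Completion.norm_coe]
    have h1 : f.leftMulMapPreGNS (q k) (f.toPreGNS (q 0)) - f.toPreGNS (q 0) =
        f.toPreGNS (q k - q 0) := by
      rw [PositiveLinearMap.leftMulMapPreGNS_apply, f.ofPreGNS_toPreGNS, hdec' 0 k (Nat.zero_le k),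
        map_sub]
    have h2 : f (star (q k - q 0) * (q k - q 0)) = 0 := by
      have : star (q k - q 0) * (q k - q 0) = q 0 - q k := by
        rw [star_sub, hs, hs, sub_mul, mul_sub, mul_sub, hp, hp, hdec 0 k (Nat.zero_le k),
          hdec' 0 k (Nat.zero_le k)]
        abel
      rw [this, map_sub, hf, hf, hφq, hφq, sub_self]
    rw [h1, f.preGNS_norm_def, f.ofPreGNS_toPreGNS, h2]
    simp

namespace AFSystem

variable {𝔄 : Type*} [NonUnitalCStarAlgebra 𝔄] {M : AFSystem 𝔄} {A : NonUnitalSubalgebra ℂ 𝔄}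

theorem exists_mem_level_of_mem_span {a : 𝔄}
    (ha : a ∈ Submodule.span ℂ {x : 𝔄 | ∃ n r i j, x = M.e n r i j}) : ∃ n, a ∈ M.level n := by
  induction ha using Submodule.span_induction with
  | mem x h => obtain ⟨n, r, i, j, rfl⟩ := h; exact ⟨n, e_mem_level _ _ _ _⟩
  | zero => exact ⟨0, zero_mem _⟩
  | add x y _ _ hx hy =>
    obtain ⟨n, hn⟩ := hx
    obtain ⟨m, hm⟩ := hy
    exact ⟨max n m, add_mem (level_mono (le_max_left _ _) hn) (level_mono (le_max_right _ _) hm)⟩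
  | smul c x _ hx => exact hx.imp fun n hn => Submodule.smul_mem _ c hn

/-- A refining sequence of cells determines a representation with a vector fixed by the diagonal
matrix units of the cells. -/
theorem exists_rep_of_cells {𝔄 : Type u} [NonUnitalCStarAlgebra 𝔄] {M : AFSystem 𝔄}
    (c : ℕ → M.Cell) (hn : ∀ k, k ≤ (c k).n) (hc : ∀ k, (c (k + 1)).Refines (c k)) :
    ∃ (K : Type u) (_ : NormedAddCommGroup K) (_ : InnerProductSpace ℂ K) (_ : CompleteSpace K)
      (π : 𝔄 →⋆ₙₐ[ℂ] (K →L[ℂ] K)) (ξ : K), ‖ξ‖ = 1 ∧ ∀ k, π (c k).q ξ = ξ := by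
  refine exists_rep_of_decreasing (fun k => (c k).q) (fun k => star_p _ _)
    (fun k => p_mul_self _ _) (fun k => p_ne_zero _ _) (fun k m hkm => ?_) M.dense_span
    fun a ha => ?_
  · induction m, hkm using Nat.le_induction with
    | base => exact p_mul_self _ _
    | succ m _ ih => rw [← (hc m).q_mul_q, ← mul_assoc, ih]
  · obtain ⟨n, hna⟩ := exists_mem_level_of_mem_span ha
    filter_upwards [eventually_ge_atTop n] with k hk
    have hl := level_mono (hk.trans (hn k)) hna
    exact exists_corner (mul_mem_level (star_mem_level hl) hl) _ _ _

end AFSystem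

/-! ### The orthonormal set attached to a refining sequence of cells. -/

namespace AFSystem

section CellVectors

variable {𝔄 : Type*} [NonUnitalCStarAlgebra 𝔄] {M : AFSystem 𝔄} {A : NonUnitalSubalgebra ℂ 𝔄}
  {K : Type*} [NormedAddCommGroup K] [InnerProductSpace ℂ K] [CompleteSpace K]

/-- The vectors obtained from a fixed vector by the matrix units in the column of a cell. -/
noncomputable def cellVec (π : 𝔄 →⋆ₙₐ[ℂ] (K →L[ℂ] K)) (ξ : K) (c : M.Cell)
    (s : Fin (M.size c.n c.r)) : K :=
  π (M.e c.n c.r s c.x) ξ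

/-- The vectors coming from the intervals of a sequence of cells. -/
def cellBasis (π : 𝔄 →⋆ₙₐ[ℂ] (K →L[ℂ] K)) (ξ : K) (c : ℕ → M.Cell) : Set K :=
  {h | ∃ k, ∃ s ∈ (c k).interval, h = cellVec π ξ (c k) s}

variable {π : 𝔄 →⋆ₙₐ[ℂ] (K →L[ℂ] K)} {ξ : K}

theorem countable_cellBasis (c : ℕ → M.Cell) : (cellBasis π ξ c).Countable := by
  have : cellBasis π ξ c ⊆ ⋃ k, Set.range (cellVec π ξ (c k)) := by
    rintro _ ⟨k, s, -, rfl⟩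
    exact Set.mem_iUnion.2 ⟨k, s, rfl⟩
  exact (Set.countable_iUnion fun k => Set.countable_range _).mono this

theorem map_e_cellVec (c : M.Cell) (r : Fin (M.blocks c.n)) (t u : Fin (M.size c.n r))
    (s : Fin (M.size c.n c.r)) (h : (⟨r, u⟩ : M.Idx c.n) ≠ ⟨c.r, s⟩) :
    π (M.e c.n r t u) (cellVec π ξ c s) = 0 := by
  rw [cellVec, ← mul_apply_eq_comp, ← map_mul]
  by_cases hr : r = c.r
  · subst hr
    rw [M.e_mul_e, if_neg fun h' => h (by rw [h'])]; simp
  · rw [M.e_mul_e_of_ne _ _ _ _ _ _ _ hr]; simp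

theorem map_e_cellVec_self (c : M.Cell) (t s : Fin (M.size c.n c.r)) :
    π (M.e c.n c.r t s) (cellVec π ξ c s) = cellVec π ξ c t := by
  rw [cellVec, ← mul_apply_eq_comp, ← map_mul, M.e_mul_e, if_pos rfl, cellVec]

theorem inner_map_left (a : 𝔄) (h k : K) : ⟪π a h, k⟫_ℂ = ⟪h, π (star a) k⟫_ℂ := by
  rw [map_star, ContinuousLinearMap.star_eq_adjoint, ContinuousLinearMap.adjoint_inner_right]

theorem inner_cellVec (hξ : ‖ξ‖ = 1) {c : M.Cell} (hc : π c.q ξ = ξ)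
    (s t : Fin (M.size c.n c.r)) :
    ⟪cellVec π ξ c s, cellVec π ξ c t⟫_ℂ = if s = t then 1 else 0 := by
  rw [cellVec, inner_map_left, M.star_e]
  split_ifs with h
  · subst h
    rw [map_e_cellVec_self, cellVec]
    change ⟪ξ, π c.q ξ⟫_ℂ = 1
    rw [hc, inner_self_eq_norm_sq_to_K, hξ]; simp
  · rw [map_e_cellVec c _ _ _ _ (by simpa using h), inner_zero_right]

/-- Since `ξ` is fixed by `c'.q`, this projection may be inserted before the unit, which turns it
into a unit of the column of `c'`. -/
theorem exists_cellVec_eq (hU : ∀ n, A.toSubmodule ⊓ M.level n = M.upper n) {c c' : M.Cell}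
    (hcc' : c'.Refines c) (hc' : π c'.q ξ = ξ) (s : Fin (M.size c.n c.r)) :
    ∃ s', cellVec π ξ c s = cellVec π ξ c' s' ∧ (s ∈ c.interval → s' ∈ c'.interval) := by
  obtain ⟨s', hs'⟩ := exists_transfer hU hcc'.le (y := ⟨c'.r, c'.x⟩) hcc'.q_mul_q s
  refine ⟨s', ?_, fun h => hcc'.transfer s h s' hs'⟩
  conv_lhs => rw [cellVec, ← hc', ← mul_apply_eq_comp, ← map_mul]
  rw [cellVec, ← hs']
  rfl

theorem exists_cellVec_eq_of_le (hU : ∀ n, A.toSubmodule ⊓ M.level n = M.upper n)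
    {c : ℕ → M.Cell} (hc : ∀ k, (c (k + 1)).Refines (c k)) (hξ : ∀ k, π (c k).q ξ = ξ) {k m : ℕ}
    (hkm : k ≤ m) (s : Fin (M.size (c k).n (c k).r)) :
    ∃ s', cellVec π ξ (c k) s = cellVec π ξ (c m) s' ∧
      (s ∈ (c k).interval → s' ∈ (c m).interval) := by
  induction m, hkm using Nat.le_induction with
  | base => exact ⟨s, rfl, id⟩
  | succ m _ ih =>
    obtain ⟨s', h, h'⟩ := ih
    obtain ⟨s'', h1, h2⟩ := exists_cellVec_eq hU (hc m) (hξ (m + 1)) s'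
    exact ⟨s'', h.trans h1, fun hs => h2 (h' hs)⟩

theorem eventually_exists_cellVec_eq (hU : ∀ n, A.toSubmodule ⊓ M.level n = M.upper n)
    {c : ℕ → M.Cell} (hc : ∀ k, (c (k + 1)).Refines (c k)) (hξ : ∀ k, π (c k).q ξ = ξ)
    {h : K} (hh : h ∈ cellBasis π ξ c) :
    ∀ᶠ k in atTop, ∃ s ∈ (c k).interval, h = cellVec π ξ (c k) s := by
  obtain ⟨m, s, hs, rfl⟩ := hh
  filter_upwards [eventually_ge_atTop m] with k hk
  obtain ⟨s', h1, h2⟩ := exists_cellVec_eq_of_le hU hc hξ hk s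
  exact ⟨s', h2 hs, h1⟩

/-- Both vectors become column vectors of one common deeper cell. The position `s` is not restricted
to the interval, which is needed for vectors that leave the span. -/
theorem inner_cellVec_eq_zero (hU : ∀ n, A.toSubmodule ⊓ M.level n = M.upper n)
    {c : ℕ → M.Cell} (hc : ∀ k, (c (k + 1)).Refines (c k)) (hξ1 : ‖ξ‖ = 1)
    (hξ : ∀ k, π (c k).q ξ = ξ) {h : K} (hh : h ∈ cellBasis π ξ c) {k : ℕ}
    {s : Fin (M.size (c k).n (c k).r)} (hne : h ≠ cellVec π ξ (c k) s) :
    ⟪h, cellVec π ξ (c k) s⟫_ℂ = 0 := by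
  obtain ⟨m, hm, hkm⟩ :=
    ((eventually_exists_cellVec_eq hU hc hξ hh).and (eventually_ge_atTop k)).exists
  obtain ⟨t, -, rfl⟩ := hm
  obtain ⟨s', h1, -⟩ := exists_cellVec_eq_of_le hU hc hξ hkm s
  rw [h1] at hne ⊢
  rw [inner_cellVec hξ1 (hξ m), if_neg]
  rintro rfl
  exact hne rfl

theorem orthonormal_cellBasis (hU : ∀ n, A.toSubmodule ⊓ M.level n = M.upper n)
    {c : ℕ → M.Cell} (hc : ∀ k, (c (k + 1)).Refines (c k)) (hξ1 : ‖ξ‖ = 1)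
    (hξ : ∀ k, π (c k).q ξ = ξ) : Orthonormal ℂ ((↑) : cellBasis π ξ c → K) := by
  refine ⟨?_, ?_⟩
  · rintro ⟨_, k, s, -, rfl⟩
    rw [norm_eq_sqrt_re_inner (𝕜 := ℂ), inner_cellVec hξ1 (hξ k), if_pos rfl]
    simp
  · rintro ⟨h, hh⟩ ⟨_, k, s, hs, rfl⟩ hne
    exact inner_cellVec_eq_zero hU hc hξ1 hξ hh fun h' => hne (Subtype.ext h')

end CellVectors

end AFSystem

/-! ### Compression of operators to an orthonormal family, modelled on `ℓ²`. -/

section Compression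

variable {ι : Type*} {K : Type*} [NormedAddCommGroup K] [InnerProductSpace ℂ K]

/-- The isometry from `ℓ²` given by an orthonormal family. -/
noncomputable def Orthonormal.isometry {b : ι → K} (hb : Orthonormal ℂ b) [CompleteSpace K] :
    lp (fun _ : ι => ℂ) 2 →ₗᵢ[ℂ] K :=
  hb.orthogonalFamily.linearIsometry

variable [CompleteSpace K] {b : ι → K} (hb : Orthonormal ℂ b)

/-- Compression of an operator to the span of an orthonormal family. -/
noncomputable def Orthonormal.compress (T : K →L[ℂ] K) :
    lp (fun _ : ι => ℂ) 2 →L[ℂ] lp (fun _ : ι => ℂ) 2 :=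
  hb.isometry.toContinuousLinearMap.adjoint ∘L T ∘L hb.isometry.toContinuousLinearMap

theorem Orthonormal.norm_compress_le (T : K →L[ℂ] K) : ‖hb.compress T‖ ≤ ‖T‖ := by
  have h1 : ‖hb.isometry.toContinuousLinearMap‖ ≤ 1 :=
    LinearIsometry.norm_toContinuousLinearMap_le _
  calc _ ≤ ‖hb.isometry.toContinuousLinearMap.adjoint‖ *
        (‖T‖ * ‖hb.isometry.toContinuousLinearMap‖) :=
        (ContinuousLinearMap.opNorm_comp_le _ _).trans
          (by gcongr; exact ContinuousLinearMap.opNorm_comp_le _ _)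
    _ ≤ 1 * (‖T‖ * 1) := by
        rw [LinearIsometryEquiv.norm_map]
        gcongr
    _ = _ := by ring

theorem Orthonormal.compress_add (S T : K →L[ℂ] K) :
    hb.compress (S + T) = hb.compress S + hb.compress T := by
  ext1 f; simp [Orthonormal.compress]

theorem Orthonormal.compress_smul (c : ℂ) (T : K →L[ℂ] K) :
    hb.compress (c • T) = c • hb.compress T := by
  ext1 f; simp [Orthonormal.compress]

variable [DecidableEq ι]

theorem Orthonormal.isometry_single (w : ι) : hb.isometry (lp.single 2 w 1) = b w := by
  rw [Orthonormal.isometry, OrthogonalFamily.linearIsometry_apply_single]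
  simp

theorem lp_ext_inner_single {f g : lp (fun _ : ι => ℂ) 2}
    (h : ∀ w, ⟪(lp.single 2 w 1 : lp (fun _ : ι => ℂ) 2), f⟫_ℂ = ⟪lp.single 2 w 1, g⟫_ℂ) :
    f = g := by
  refine lp.ext (funext fun w => ?_)
  simpa [lp.inner_single_left] using h w

/-- A closed subspace of `ℓ²` contains every vector supported on basis vectors in it. -/
theorem mem_of_single_mem {L : Submodule ℂ (lp (fun _ : ι => ℂ) 2)}
    (hL : IsClosed (L : Set (lp (fun _ : ι => ℂ) 2))) {h : lp (fun _ : ι => ℂ) 2}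
    (hh : ∀ w, h w ≠ 0 → (lp.single 2 w 1 : lp (fun _ : ι => ℂ) 2) ∈ L) : h ∈ L := by
  have hsum := lp.hasSum_single (E := fun _ : ι => ℂ) (p := 2) (by norm_num) h
  refine hL.mem_of_tendsto hsum (Eventually.of_forall fun F => Submodule.sum_mem _ fun w _ => ?_)
  by_cases hw : h w = 0
  · rw [hw]; simp
  · have : (lp.single 2 w (h w) : lp (fun _ : ι => ℂ) 2) = h w • lp.single 2 w 1 := by
      rw [← lp.single_smul]; simp
    rw [this]
    exact L.smul_mem _ (hh w hw)

theorem clm_ext_single {S T : lp (fun _ : ι => ℂ) 2 →L[ℂ] lp (fun _ : ι => ℂ) 2}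
    (h : ∀ w, S (lp.single 2 w 1) = T (lp.single 2 w 1)) : S = T := by
  refine ContinuousLinearMap.ext fun f => ?_
  have : f ∈ LinearMap.ker (S - T).toLinearMap := by
    refine mem_of_single_mem (ContinuousLinearMap.isClosed_ker (S - T)) fun w _ => ?_
    simp [h w]
  simpa [sub_eq_zero] using this

theorem Orthonormal.inner_single_adjoint (w : ι) (k : K) :
    ⟪(lp.single 2 w 1 : lp (fun _ : ι => ℂ) 2),
      hb.isometry.toContinuousLinearMap.adjoint k⟫_ℂ = ⟪b w, k⟫_ℂ := by
  rw [ContinuousLinearMap.adjoint_inner_right]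
  change ⟪hb.isometry _, k⟫_ℂ = _
  rw [hb.isometry_single]

theorem Orthonormal.adjoint_apply (w : ι) :
    hb.isometry.toContinuousLinearMap.adjoint (b w) = lp.single 2 w 1 := by
  refine lp_ext_inner_single fun w' => ?_
  rw [hb.inner_single_adjoint, orthonormal_iff_ite.1 hb, lp.inner_single_left]
  simp [lp.single_apply, Pi.single_apply]

theorem Orthonormal.adjoint_eq_zero {k : K} (hk : ∀ w, ⟪b w, k⟫_ℂ = 0) :
    hb.isometry.toContinuousLinearMap.adjoint k = 0 :=
  lp_ext_inner_single fun w => by rw [hb.inner_single_adjoint, hk, inner_zero_right]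

theorem Orthonormal.compress_single (T : K →L[ℂ] K) (w : ι) :
    hb.compress T (lp.single 2 w 1) = hb.isometry.toContinuousLinearMap.adjoint (T (b w)) := by
  change hb.isometry.toContinuousLinearMap.adjoint (T (hb.isometry _)) = _
  rw [hb.isometry_single]

end Compression

section StarRep

variable {𝔄 : Type*} [NonUnitalCStarAlgebra 𝔄] {K : Type*} [NormedAddCommGroup K]
  [InnerProductSpace ℂ K] [CompleteSpace K]

/-- A representation of a C*-algebra as a continuous linear map. -/
noncomputable def repCLM (π : 𝔄 →⋆ₙₐ[ℂ] (K →L[ℂ] K)) : 𝔄 →L[ℂ] (K →L[ℂ] K) :=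
  LinearMap.mkContinuous
    { toFun := π, map_add' := map_add π, map_smul' := fun c a => map_smul π c a } 1 fun a => by
      simpa using NonUnitalStarAlgHom.norm_apply_le π a

/-- The compression of a representation to the span of an orthonormal family. -/
noncomputable def compressCLM (π : 𝔄 →⋆ₙₐ[ℂ] (K →L[ℂ] K)) {ι : Type*} {b : ι → K}
    (hb : Orthonormal ℂ b) :
    𝔄 →L[ℂ] (lp (fun _ : ι => ℂ) 2 →L[ℂ] lp (fun _ : ι => ℂ) 2) :=
  LinearMap.mkContinuous
    { toFun := fun a => hb.compress (π a)
      map_add' := fun a a' => by rw [map_add, hb.compress_add]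
      map_smul' := fun c a => by rw [map_smul, hb.compress_smul, RingHom.id_apply] } 1 fun a => by
      rw [one_mul]
      exact (hb.norm_compress_le _).trans (NonUnitalStarAlgHom.norm_apply_le π a)

theorem compressCLM_apply (π : 𝔄 →⋆ₙₐ[ℂ] (K →L[ℂ] K)) {ι : Type*} {b : ι → K}
    (hb : Orthonormal ℂ b) (a : 𝔄) : compressCLM π hb a = hb.compress (π a) := rfl

theorem norm_compressCLM_apply_le (π : 𝔄 →⋆ₙₐ[ℂ] (K →L[ℂ] K)) {ι : Type*} {b : ι → K}
    (hb : Orthonormal ℂ b) (a : 𝔄) : ‖compressCLM π hb a‖ ≤ ‖a‖ :=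
  (hb.norm_compress_le _).trans (NonUnitalStarAlgHom.norm_apply_le π a)

end StarRep

/-! ### The compressed representation: multiplicativity, kernel and invariant subspaces. -/

namespace AFSystem

variable {𝔄 : Type*} [NonUnitalCStarAlgebra 𝔄] {M : AFSystem 𝔄} {A : NonUnitalSubalgebra ℂ 𝔄}
  {K : Type*} [NormedAddCommGroup K] [InnerProductSpace ℂ K] [CompleteSpace K]
  {π : 𝔄 →⋆ₙₐ[ℂ] (K →L[ℂ] K)} {ξ : K} {c : ℕ → M.Cell} {ι : Type*} {b : ι → K}
  [DecidableEq ι]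

theorem inner_compress (hb : Orthonormal ℂ b) (T : K →L[ℂ] K) (w w' : ι) :
    ⟪(lp.single 2 w' 1 : lp (fun _ : ι => ℂ) 2), hb.compress T (lp.single 2 w 1)⟫_ℂ =
      ⟪b w', T (b w)⟫_ℂ := by
  rw [hb.compress_single, hb.inner_single_adjoint]

/-- The right unit moves position `s` up to `i'`. If the vector at `i'` is not a basis vector it is
orthogonal to the span; a return to `s'` by the left unit would give `s' ≤ i' ≤ s`, placing `i'` in
the interval after all. -/
theorem inner_defect_unit (hU : ∀ n, A.toSubmodule ⊓ M.level n = M.upper n)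
    (hc : ∀ k, (c (k + 1)).Refines (c k)) (hξ1 : ‖ξ‖ = 1) (hξ : ∀ k, π (c k).q ξ = ξ)
    (hb : Orthonormal ℂ b) (hbr : Set.range b = cellBasis π ξ c) {k : ℕ}
    {s s' : Fin (M.size (c k).n (c k).r)} (hs : s ∈ (c k).interval) (hs' : s' ∈ (c k).interval)
    {t t' : Fin (M.blocks (c k).n)} {i j : Fin (M.size (c k).n t)}
    {i' j' : Fin (M.size (c k).n t')} (hij : i ≤ j) (hij' : i' ≤ j') :
    ⟪cellVec π ξ (c k) s', π (M.e (c k).n t i j) (hb.isometry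
      (hb.isometry.toContinuousLinearMap.adjoint (π (M.e (c k).n t' i' j') (cellVec π ξ (c k) s)))
        - π (M.e (c k).n t' i' j') (cellVec π ξ (c k) s))⟫_ℂ = 0 := by
  by_cases h1 : (⟨t', j'⟩ : M.Idx (c k).n) = ⟨(c k).r, s⟩
  swap
  · rw [map_e_cellVec _ _ _ _ _ h1]; simp
  obtain rfl : t' = (c k).r := congrArg Sigma.fst h1
  obtain rfl : j' = s := by simpa using h1
  rw [map_e_cellVec_self]
  by_cases hΩ : cellVec π ξ (c k) i' ∈ cellBasis π ξ c
  · rw [← hbr] at hΩ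
    obtain ⟨w, hw⟩ := hΩ
    rw [← hw, hb.adjoint_apply, hb.isometry_single]; simp
  · have hzero : hb.isometry.toContinuousLinearMap.adjoint (cellVec π ξ (c k) i') = 0 := by
      refine hb.adjoint_eq_zero fun w => ?_
      have hw : b w ∈ cellBasis π ξ c := hbr ▸ Set.mem_range_self w
      refine inner_cellVec_eq_zero hU hc hξ1 hξ hw ?_
      intro h
      exact hΩ (h ▸ hw)
    rw [hzero, map_zero, zero_sub, map_neg, inner_neg_right, neg_eq_zero]
    by_cases h2 : (⟨t, j⟩ : M.Idx (c k).n) = ⟨(c k).r, i'⟩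
    swap
    · rw [map_e_cellVec _ _ _ _ _ h2, inner_zero_right]
    obtain rfl : t = (c k).r := congrArg Sigma.fst h2
    obtain rfl : j = i' := by simpa using h2
    rw [map_e_cellVec_self, inner_cellVec hξ1 (hξ k), if_neg]
    rintro rfl
    exact hΩ ⟨k, j, ⟨hs'.1.trans hij, hij'.trans hs.2⟩, rfl⟩

/-- The defect is linear and continuous in each argument, so it suffices to test units of one level
at which both basis vectors are visible. -/
theorem inner_defect (hA : IsTAF M A) (hU : ∀ n, A.toSubmodule ⊓ M.level n = M.upper n)
    (hn : ∀ k, k ≤ (c k).n) (hc : ∀ k, (c (k + 1)).Refines (c k)) (hξ1 : ‖ξ‖ = 1)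
    (hξ : ∀ k, π (c k).q ξ = ξ) (hb : Orthonormal ℂ b) (hbr : Set.range b = cellBasis π ξ c)
    (w w' : ι) {a a' : 𝔄} (ha : a ∈ A) (ha' : a' ∈ A) :
    ⟪b w', π a (hb.isometry (hb.isometry.toContinuousLinearMap.adjoint (π a' (b w))) -
      π a' (b w))⟫_ℂ = 0 := by
  let D : K →L[ℂ] K := hb.isometry.toContinuousLinearMap ∘L
    hb.isometry.toContinuousLinearMap.adjoint - ContinuousLinearMap.id ℂ K
  -- The same number, read as a functional of the first or of the second argument.
  let left : K → (𝔄 →L[ℂ] ℂ) := fun y =>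
    innerSL ℂ (b w') ∘L ContinuousLinearMap.apply ℂ K y ∘L repCLM π
  let right : 𝔄 → (𝔄 →L[ℂ] ℂ) := fun a =>
    innerSL ℂ (b w') ∘L π a ∘L D ∘L ContinuousLinearMap.apply ℂ K (b w) ∘L repCLM π
  have hlr : ∀ a a', left (D (π a' (b w))) a = right a a' := fun a a' => rfl
  change right a a' = 0
  have hw : ∀ w, b w ∈ cellBasis π ξ c := fun w => hbr ▸ Set.mem_range_self w
  have hfin : ∀ n m, ∀ a ∈ M.upper n, ∀ a' ∈ M.upper m, right a a' = 0 := by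
    intro n m a ha a' ha'
    obtain ⟨k, ⟨⟨s, hs, hsw⟩, ⟨s', hs', hsw'⟩⟩, hnk, hmk⟩ :=
      (((eventually_exists_cellVec_eq hU hc hξ (hw w)).and
        (eventually_exists_cellVec_eq hU hc hξ (hw w'))).and
          ((eventually_ge_atTop n).and (eventually_ge_atTop m))).exists
    have hunit : ∀ (t : Fin (M.blocks (c k).n)) (i j : Fin (M.size (c k).n t)), i ≤ j →
        ∀ (t' : Fin (M.blocks (c k).n)) (i' j' : Fin (M.size (c k).n t')), i' ≤ j' →
        right (M.e (c k).n t i j) (M.e (c k).n t' i' j') = 0 := by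
      intro t i j hij t' i' j' hij'
      have := inner_defect_unit hU hc hξ1 hξ hb hbr hs hs' hij hij'
      rw [← hsw, ← hsw'] at this
      exact this
    have h1 : ∀ (t : Fin (M.blocks (c k).n)) (i j : Fin (M.size (c k).n t)), i ≤ j →
        right (M.e (c k).n t i j) a' = 0 := by
      intro t i j hij
      have : M.upper (c k).n ≤ LinearMap.ker (right (M.e (c k).n t i j)).toLinearMap := by
        refine Submodule.span_le.2 ?_
        rintro _ ⟨t', i', j', hij', rfl⟩
        exact hunit t i j hij t' i' j' hij'
      exact this (upper_mono hU (hmk.trans (hn k)) ha')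
    have : M.upper (c k).n ≤ LinearMap.ker (left (D (π a' (b w)))).toLinearMap := by
      refine Submodule.span_le.2 ?_
      rintro _ ⟨t, i, j, hij, rfl⟩
      exact h1 t i j hij
    exact this (upper_mono hU (hnk.trans (hn k)) ha)
  have hhalf : ∀ m, ∀ a' ∈ M.upper m, right a a' = 0 := by
    intro m a' ha'
    have : A.toSubmodule ≤ LinearMap.ker (left (D (π a' (b w)))).toLinearMap :=
      le_of_upper_le hA hU (ContinuousLinearMap.isClosed_ker _) fun n a ha => hfin n m a ha a' ha'
    exact this ha
  have : A.toSubmodule ≤ LinearMap.ker (right a).toLinearMap :=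
    le_of_upper_le hA hU (ContinuousLinearMap.isClosed_ker _) hhalf
  exact this ha'

/-- Compression to the span of the basis vectors of a sequence of cells is multiplicative. -/
theorem compressCLM_mul (hA : IsTAF M A) (hU : ∀ n, A.toSubmodule ⊓ M.level n = M.upper n)
    (hn : ∀ k, k ≤ (c k).n) (hc : ∀ k, (c (k + 1)).Refines (c k)) (hξ1 : ‖ξ‖ = 1)
    (hξ : ∀ k, π (c k).q ξ = ξ) (hb : Orthonormal ℂ b) (hbr : Set.range b = cellBasis π ξ c)
    {a a' : 𝔄} (ha : a ∈ A) (ha' : a' ∈ A) :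
    compressCLM π hb (a * a') = compressCLM π hb a * compressCLM π hb a' := by
  refine clm_ext_single fun w => lp_ext_inner_single fun w' => ?_
  have h := inner_defect hA hU hn hc hξ1 hξ hb hbr w w' ha ha'
  rw [map_sub, inner_sub_right, sub_eq_zero] at h
  rw [compressCLM_apply, inner_compress, map_mul, mul_apply_eq_comp, mul_apply_eq_comp,
    compressCLM_apply, compressCLM_apply, hb.compress_single, ← h]
  change _ = ⟪_, hb.isometry.toContinuousLinearMap.adjoint (π a (hb.isometry _))⟫_ℂ
  rw [hb.inner_single_adjoint]

/-- The compressed representation of `A`. -/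
noncomputable def compressHom (hA : IsTAF M A)
    (hU : ∀ n, A.toSubmodule ⊓ M.level n = M.upper n)
    (hn : ∀ k, k ≤ (c k).n) (hc : ∀ k, (c (k + 1)).Refines (c k)) (hξ1 : ‖ξ‖ = 1)
    (hξ : ∀ k, π (c k).q ξ = ξ) (hb : Orthonormal ℂ b) (hbr : Set.range b = cellBasis π ξ c) :
    A →ₙₐ[ℂ] (lp (fun _ : ι => ℂ) 2 →L[ℂ] lp (fun _ : ι => ℂ) 2) where
  toFun a := compressCLM π hb a
  map_smul' z a := map_smul (compressCLM π hb) z (a : 𝔄)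
  map_zero' := map_zero (compressCLM π hb)
  map_add' a a' := map_add (compressCLM π hb) (a : 𝔄) (a' : 𝔄)
  map_mul' a a' := compressCLM_mul hA hU hn hc hξ1 hξ hb hbr a.2 a'.2

/-- The kernel of the compressed representation. -/
theorem compressCLM_eq_zero_iff (hA : IsTAF M A)
    (hU : ∀ n, A.toSubmodule ⊓ M.level n = M.upper n)
    (hn : ∀ k, k ≤ (c k).n) (hc : ∀ k, (c (k + 1)).Refines (c k)) (hξ1 : ‖ξ‖ = 1)
    (hξ : ∀ k, π (c k).q ξ = ξ) (hb : Orthonormal ℂ b) (hbr : Set.range b = cellBasis π ξ c)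
    {J : Submodule ℂ 𝔄} (hJ : IsClosedIdeal A J) (hcJ : ∀ k, (c k).unit ∉ J)
    (hdom : ∀ f : M.Cell, f.unit ∉ J → ∃ k u v, (c k).i ≤ u ∧ v ≤ (c k).j ∧
        M.e (c k).n (c k).r u u * f.unit * M.e (c k).n (c k).r v v = M.e (c k).n (c k).r u v)
    {a : 𝔄} (ha : a ∈ A) : compressCLM π hb a = 0 ↔ a ∈ J := by
  let S : Submodule ℂ 𝔄 := LinearMap.ker (compressCLM π hb).toLinearMap
  have hS : IsClosed (S : Set 𝔄) := ContinuousLinearMap.isClosed_ker (compressCLM π hb)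
  have hmul := fun {a a' : 𝔄} (ha : a ∈ A) (ha' : a' ∈ A) =>
    compressCLM_mul hA hU hn hc hξ1 hξ hb hbr ha ha'
  have hSA : IsClosedIdeal A (S ⊓ A.toSubmodule) :=
    { le := inf_le_right
      isClosed := hS.inter hA.isClosed
      mul_left := fun a ha x hx => ⟨by
        change compressCLM π hb (a * x) = 0
        rw [hmul ha hx.2, show compressCLM π hb x = 0 from hx.1, mul_zero], A.mul_mem ha hx.2⟩
      mul_right := fun a ha x hx => ⟨by
        change compressCLM π hb (x * a) = 0
        rw [hmul hx.2 ha, show compressCLM π hb x = 0 from hx.1, zero_mul], A.mul_mem hx.2 ha⟩ }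
  have hw : ∀ w, b w ∈ cellBasis π ξ c := fun w => hbr ▸ Set.mem_range_self w
  have h1 : J ≤ S := by
    refine le_of_e_mem hA hU hJ hS fun n r i j he => ?_
    change compressCLM π hb _ = 0
    refine clm_ext_single fun w => lp_ext_inner_single fun w' => ?_
    rw [compressCLM_apply, inner_compress, zero_apply, inner_zero_right]
    obtain ⟨k, ⟨⟨s, hs, hsw⟩, ⟨s', hs', hsw'⟩⟩, hnk⟩ :=
      (((eventually_exists_cellVec_eq hU hc hξ (hw w)).and
        (eventually_exists_cellVec_eq hU hc hξ (hw w'))).and (eventually_ge_atTop n)).exists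
    rw [hsw, hsw']
    have hl := level_mono (hnk.trans (hn k)) (e_mem_level (M := M) n r i j)
    obtain ⟨z, hz⟩ := exists_corner hl (c k).r s' s
    have h2 : ⟪cellVec π ξ (c k) s', π (M.e n r i j) (cellVec π ξ (c k) s)⟫_ℂ = z := by
      conv_lhs => rw [← map_e_cellVec_self (c k) s' s', ← map_e_cellVec_self (c k) s s,
        inner_map_left, M.star_e, ← mul_apply_eq_comp, ← mul_apply_eq_comp, ← map_mul, ← map_mul,
        hz, map_smul, smul_apply, map_e_cellVec_self,
        inner_smul_right, inner_cellVec hξ1 (hξ k), if_pos rfl, mul_one]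
    rw [h2]
    -- A nonzero coefficient would put a unit with row and column in the interval of `c k` into `J`;
    -- multiplying it out to the corner `(i, j)` would put the unit of `c k` there too.
    by_contra hz0
    have h3 : z • M.e (c k).n (c k).r s' s ∈ J := by
      rw [← hz]
      exact hJ.mul_right _ (e_mem hU le_rfl) _ (hJ.mul_left _ (e_mem hU le_rfl) _ he)
    have h4 : M.e (c k).n (c k).r s' s ∈ J := by
      have := J.smul_mem z⁻¹ h3
      rwa [smul_smul, inv_mul_cancel₀ hz0, one_smul] at this
    have h5 := hJ.mul_right _ (e_mem hU hs.2) _ (hJ.mul_left _ (e_mem hU hs'.1) _ h4)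
    rw [M.e_mul_e, if_pos rfl, M.e_mul_e, if_pos rfl] at h5
    exact hcJ k h5
  have h2 : S ⊓ A.toSubmodule ≤ J := by
    refine le_of_e_mem hA hU hSA hJ.isClosed fun n r i j he => ?_
    by_contra heJ
    have hij : i ≤ j := (e_mem_iff hU).1 he.2
    obtain ⟨k, u, v, hu, hv, huv⟩ := hdom ⟨n, r, i, j, i, le_rfl, hij⟩ heJ
    have h3 : M.e (c k).n (c k).r (c k).i u * M.e n r i j * M.e (c k).n (c k).r v (c k).j =
        M.e (c k).n (c k).r (c k).i (c k).j := by
      have e1 : M.e (c k).n (c k).r (c k).i u =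
          M.e (c k).n (c k).r (c k).i u * M.e (c k).n (c k).r u u := by
        rw [M.e_mul_e, if_pos rfl]
      have e2 : M.e (c k).n (c k).r v (c k).j =
          M.e (c k).n (c k).r v v * M.e (c k).n (c k).r v (c k).j := by
        rw [M.e_mul_e, if_pos rfl]
      have huv' : M.e (c k).n (c k).r u u * (M.e n r i j * M.e (c k).n (c k).r v v) =
        M.e (c k).n (c k).r u v := by rw [← mul_assoc]; exact huv
      rw [e1, e2, mul_assoc, mul_assoc, ← mul_assoc (M.e n r i j), ← mul_assoc (M.e _ _ u u),
        huv', M.e_mul_e, if_pos rfl, M.e_mul_e, if_pos rfl]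
    -- The unit of the cell would then lie in the kernel, but it carries the basis vector at `j` to
    -- the one at `i`.
    have h4 := hSA.mul_right _ (e_mem hU hv) _ (hSA.mul_left _ (e_mem hU hu) _ he)
    rw [h3] at h4
    have hle := (c k).i_le.trans (c k).le_j
    obtain ⟨w, hwj⟩ : cellVec π ξ (c k) (c k).j ∈ Set.range b :=
      hbr ▸ ⟨k, (c k).j, ⟨hle, le_rfl⟩, rfl⟩
    obtain ⟨w', hwi⟩ : cellVec π ξ (c k) (c k).i ∈ Set.range b :=
      hbr ▸ ⟨k, (c k).i, ⟨le_rfl, hle⟩, rfl⟩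
    have h5 := inner_compress hb (π (M.e (c k).n (c k).r (c k).i (c k).j)) w w'
    rw [hwj, hwi, map_e_cellVec_self, inner_cellVec hξ1 (hξ k), if_pos rfl, ← compressCLM_apply,
      show compressCLM π hb _ = 0 from h4.1] at h5
    simp at h5
  exact ⟨fun h => h2 ⟨h, ha⟩, fun h => h1 h⟩

/-- A closed invariant subspace contains the basis vectors in the support of its elements: the
diagonal matrix units around a basis vector converge strongly to its coordinate projection. -/
theorem single_mem_of_ne_zero (hU : ∀ n, A.toSubmodule ⊓ M.level n = M.upper n)
    (hc : ∀ k, (c (k + 1)).Refines (c k)) (hξ1 : ‖ξ‖ = 1) (hξ : ∀ k, π (c k).q ξ = ξ)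
    (hb : Orthonormal ℂ b) (hbr : Set.range b = cellBasis π ξ c)
    {L : Submodule ℂ (lp (fun _ : ι => ℂ) 2)} (hL : IsClosed (L : Set (lp (fun _ : ι => ℂ) 2)))
    (hinv : ∀ a ∈ A, ∀ h ∈ L, compressCLM π hb a h ∈ L) {h : lp (fun _ : ι => ℂ) 2} (hh : h ∈ L)
    {w : ι} (hw0 : h w ≠ 0) : (lp.single 2 w 1 : lp (fun _ : ι => ℂ) 2) ∈ L := by
  have hw : ∀ w, b w ∈ cellBasis π ξ c := fun w => hbr ▸ Set.mem_range_self w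
  have hsub : ∀ k, ∃ s, (∃ s' ∈ (c k).interval, b w = cellVec π ξ (c k) s') →
      b w = cellVec π ξ (c k) s := fun k => by
    by_cases h : ∃ s' ∈ (c k).interval, b w = cellVec π ξ (c k) s'
    · exact h.imp fun s' hs' _ => hs'.2
    -- Arbitrary value: `b w` is visible in all late cells, and only these matter for the limit.
    · exact ⟨(c k).x, fun h' => absurd h' h⟩
  choose s hs using hsub
  let T : ℕ → (lp (fun _ : ι => ℂ) 2 →L[ℂ] lp (fun _ : ι => ℂ) 2) := fun k =>
    compressCLM π hb (M.e (c k).n (c k).r (s k) (s k))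
  have hT1 : ∀ k g, ‖T k g‖ ≤ ‖g‖ := fun k g => by
    refine ((T k).le_opNorm g).trans ?_
    have := norm_compressCLM_apply_le π hb (M.e (c k).n (c k).r (s k) (s k))
    rw [norm_e] at this
    exact mul_le_of_le_one_left (norm_nonneg _) this
  let E : lp (fun _ : ι => ℂ) 2 →L[ℂ] lp (fun _ : ι => ℂ) 2 :=
    (innerSL ℂ (lp.single 2 w 1 : lp (fun _ : ι => ℂ) 2)).smulRight (lp.single 2 w 1)
  have hE : ∀ g, E g = g w • lp.single 2 w 1 := fun g => by
    simp [E, lp.inner_single_left]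
  have hE1 : ∀ g, ‖E g‖ ≤ ‖g‖ := fun g => by
    rw [hE, norm_smul, lp.norm_single (by norm_num)]
    simpa using lp.norm_apply_le_norm (by norm_num) g w
  -- The vectors at which `T k` converges to the coordinate projection `E`; this subspace is closed
  -- because all operators involved are contractions.
  let G : Submodule ℂ (lp (fun _ : ι => ℂ) 2) :=
    { carrier := {g | Tendsto (fun k => T k g) atTop (𝓝 (E g))}
      zero_mem' := by simp
      add_mem' := fun {x y} hx hy => by
        simpa only [Set.mem_ofPred_eq, map_add] using Tendsto.add hx hy
      smul_mem' := fun z x hx => by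
        simpa only [Set.mem_ofPred_eq, map_smul] using Tendsto.const_smul hx z }
  have hG : IsClosed (G : Set (lp (fun _ : ι => ℂ) 2)) := by
    refine isClosed_of_closure_subset fun g hg => ?_
    change Tendsto (fun k => T k g) atTop (𝓝 (E g))
    rw [Metric.tendsto_atTop]
    intro ε hε
    obtain ⟨g', hg', hd⟩ := Metric.mem_closure_iff.1 hg (ε / 3) (by positivity)
    obtain ⟨N, hN⟩ := Metric.tendsto_atTop.1 (show Tendsto _ _ _ from hg') (ε / 3) (by positivity)
    refine ⟨N, fun k hk => ?_⟩
    have h1 := hN k hk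
    rw [dist_eq_norm] at h1 hd ⊢
    have h2 : T k g - E g = T k (g - g') + (T k g' - E g') - E (g - g') := by
      rw [map_sub, map_sub]; abel
    rw [h2]
    linarith [norm_sub_le (T k (g - g') + (T k g' - E g')) (E (g - g')),
      norm_add_le (T k (g - g')) (T k g' - E g'), hT1 k (g - g'), hE1 (g - g')]
  have hsingle : ∀ w', (lp.single 2 w' 1 : lp (fun _ : ι => ℂ) 2) ∈ G := fun w' => by
    change Tendsto (fun k => T k (lp.single 2 w' 1)) atTop (𝓝 (E (lp.single 2 w' 1)))
    refine tendsto_const_nhds.congr' ?_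
    filter_upwards [eventually_exists_cellVec_eq hU hc hξ (hw w),
      eventually_exists_cellVec_eq hU hc hξ (hw w')] with k hk hk'
    have hsk := hs k hk
    obtain ⟨s', -, hs'⟩ := hk'
    simp only [T]
    rw [compressCLM_apply, hb.compress_single, hs', hE]
    by_cases hww : w' = w
    · subst hww
      rw [hsk] at hs'
      have hss : s k = s' := by
        by_contra hne
        have h1 := inner_cellVec hξ1 (hξ k) (s k) s'
        rw [if_neg hne, ← hs', inner_cellVec hξ1 (hξ k), if_pos rfl] at h1
        exact one_ne_zero h1
      rw [← hss, map_e_cellVec_self, ← hsk, hb.adjoint_apply]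
      simp
    · have hne : s k ≠ s' := by
        rintro hss
        rw [← hss, ← hsk] at hs'
        exact hww (hb.linearIndependent.injective hs')
      rw [map_e_cellVec _ _ _ _ _ (by simpa using hne), map_zero]
      simp [lp.single_apply, Ne.symm hww]
  have hlim : Tendsto (fun k => T k h) atTop (𝓝 (E h)) :=
    mem_of_single_mem hG fun w' _ => hsingle w'
  have hEL : E h ∈ L := hL.mem_of_tendsto hlim (Eventually.of_forall fun k =>
    hinv _ (e_mem hU le_rfl) h hh)
  rw [hE] at hEL
  have := L.smul_mem (h w)⁻¹ hEL
  rwa [smul_smul, inv_mul_cancel₀ hw0, one_smul] at this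

/-- The compressed representation is a bounded nest representation. -/
theorem isBoundedNestRep_compressHom (hA : IsTAF M A)
    (hU : ∀ n, A.toSubmodule ⊓ M.level n = M.upper n)
    (hn : ∀ k, k ≤ (c k).n) (hc : ∀ k, (c (k + 1)).Refines (c k)) (hξ1 : ‖ξ‖ = 1)
    (hξ : ∀ k, π (c k).q ξ = ξ) (hb : Orthonormal ℂ b) (hbr : Set.range b = cellBasis π ξ c) :
    IsBoundedNestRep (compressHom hA hU hn hc hξ1 hξ hb hbr) where
  bounded := ⟨1, fun a => by
    rw [one_mul]; exact norm_compressCLM_apply_le π hb (a : 𝔄)⟩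
  nest := by
    intro L L' hL hL' hinv hinv'
    have hw : ∀ w, b w ∈ cellBasis π ξ c := fun w => hbr ▸ Set.mem_range_self w
    have key : ∀ {L L' : Submodule ℂ (lp (fun _ : ι => ℂ) 2)},
        IsClosed (L : Set (lp (fun _ : ι => ℂ) 2)) → IsClosed (L' : Set (lp (fun _ : ι => ℂ) 2)) →
        (∀ a ∈ A, ∀ h ∈ L, compressCLM π hb a h ∈ L) → ¬ L ≤ L' →
        ∃ w, (lp.single 2 w 1 : lp (fun _ : ι => ℂ) 2) ∈ L ∧
          (lp.single 2 w 1 : lp (fun _ : ι => ℂ) 2) ∉ L' := by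
      intro L L' hL hL' hinv hle
      obtain ⟨h, hh, hh'⟩ := SetLike.not_le_iff_exists.1 hle
      by_contra hcon
      push Not at hcon
      exact hh' (mem_of_single_mem hL' fun w hw0 =>
        hcon w (single_mem_of_ne_zero hU hc hξ1 hξ hb hbr hL hinv hh hw0))
    have hinvL : ∀ a ∈ A, ∀ h ∈ L, compressCLM π hb a h ∈ L := fun a ha => hinv ⟨a, ha⟩
    have hinvL' : ∀ a ∈ A, ∀ h ∈ L', compressCLM π hb a h ∈ L' := fun a ha => hinv' ⟨a, ha⟩
    by_contra hcon
    push Not at hcon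
    obtain ⟨w, hwL, hwL'⟩ := key hL hL' hinvL hcon.1
    obtain ⟨w', hwL₂, hwL₂'⟩ := key hL' hL hinvL' hcon.2
    obtain ⟨k, ⟨s, -, hsw⟩, ⟨s', -, hsw'⟩⟩ :=
      ((eventually_exists_cellVec_eq hU hc hξ (hw w)).and
        (eventually_exists_cellVec_eq hU hc hξ (hw w'))).exists
    have hmove : ∀ {t t' : Fin (M.size (c k).n (c k).r)} {v v' : ι}, b v = cellVec π ξ (c k) t →
        b v' = cellVec π ξ (c k) t' → compressCLM π hb (M.e (c k).n (c k).r t t')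
          (lp.single 2 v' 1) = lp.single 2 v 1 := by
      intro t t' v v' hv hv'
      rw [compressCLM_apply, hb.compress_single, hv', map_e_cellVec_self, ← hv, hb.adjoint_apply]
    -- At a common cell, a unit of `A` maps the basis vector at the later position to that at the
    -- earlier one, so an invariant subspace containing the later vector contains the earlier.
    rcases le_total s s' with h | h
    · exact hwL' (hmove hsw hsw' ▸ hinvL' _ (e_mem hU h) _ hwL₂)
    · exact hwL₂' (hmove hsw' hsw ▸ hinvL _ (e_mem hU h) _ hwL)

end AFSystem

/-! ### Assembling the two directions. -/

/-- Every meet irreducible ideal is the kernel of a bounded nest representation. -/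
theorem IsMeetIrreducible.isNPrimitive {𝔄 : Type u} [NonUnitalCStarAlgebra 𝔄]
    {M : AFSystem 𝔄} {A : NonUnitalSubalgebra ℂ 𝔄} (hA : IsTAF M A)
    (hU : ∀ n, A.toSubmodule ⊓ M.level n = M.upper n) {J : TwoSidedIdeal A}
    (hJ : IsMeetIrreducible J) : IsNPrimitive.{v} J := by
  classical
  obtain ⟨I, hI, hIJ⟩ := AFSystem.exists_isClosedIdeal hA hU hJ.1
  by_cases hne : ∃ c : M.Cell, c.unit ∉ I
  · have hmeet : ∀ I₁ I₂ : Submodule ℂ 𝔄, IsClosedIdeal A I₁ → IsClosedIdeal A I₂ → I ≤ I₁ →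
        I ≤ I₂ → I₁ ⊓ I₂ = I → I₁ = I ∨ I₂ = I := by
      intro I₁ I₂ h₁ h₂ hle₁ hle₂ hinf
      have hback : ∀ {I' : Submodule ℂ 𝔄} (h' : IsClosedIdeal A I'), I ≤ I' →
          h'.toTwoSidedIdeal = J → I' = I := fun h' hle heq => by
        refine le_antisymm (fun a ha => ?_) hle
        rw [show a = ((⟨a, h'.le ha⟩ : A) : 𝔄) from rfl, hIJ, ← heq]
        exact (h'.mem_toTwoSidedIdeal _).2 ha
      have hto : ∀ {I' : Submodule ℂ 𝔄} (h' : IsClosedIdeal A I'), I ≤ I' →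
          J ≤ h'.toTwoSidedIdeal := fun h' hle a ha =>
        (h'.mem_toTwoSidedIdeal a).2 (hle ((hIJ a).2 ha))
      refine (hJ.2 h₁.toTwoSidedIdeal h₂.toTwoSidedIdeal h₁.isClosed_toTwoSidedIdeal
        h₂.isClosed_toTwoSidedIdeal (hto h₁ hle₁) (hto h₂ hle₂) ?_).imp (hback h₁ hle₁)
        (hback h₂ hle₂)
      ext a
      rw [TwoSidedIdeal.mem_inf, h₁.mem_toTwoSidedIdeal, h₂.mem_toTwoSidedIdeal,
        ← Submodule.mem_inf, hinf, hIJ]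
    obtain ⟨c, hcI, hn, hc, hdom⟩ := AFSystem.exists_cell_seq hA hU hI hmeet hne
    obtain ⟨K, _, _, _, π, ξ, hξ1, hξ⟩ := AFSystem.exists_rep_of_cells c hn hc
    have : Countable (AFSystem.cellBasis π ξ c) := (AFSystem.countable_cellBasis c).to_subtype
    -- The GNS space lives in the universe of `𝔄`; the basis is countable, so its index set, and
    -- with it the `ℓ²` space, can be moved to the universe `v`.
    let φ := equivShrink.{v} (AFSystem.cellBasis π ξ c)
    let b : Shrink.{v} (AFSystem.cellBasis π ξ c) → K := fun w => (φ.symm w : K)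
    have hb : Orthonormal ℂ b :=
      (AFSystem.orthonormal_cellBasis hU hc hξ1 hξ).comp _ φ.symm.injective
    have hbr : Set.range b = AFSystem.cellBasis π ξ c := by
      rw [show b = Subtype.val ∘ φ.symm from rfl, φ.symm.surjective.range_comp,
        Subtype.range_coe]
    refine ⟨_, inferInstance, inferInstance, inferInstance,
      AFSystem.compressHom hA hU hn hc hξ1 hξ hb hbr,
      AFSystem.isBoundedNestRep_compressHom hA hU hn hc hξ1 hξ hb hbr, ?_⟩
    ext a
    rw [TwoSidedIdeal.mem_ker, ← hIJ]
    exact AFSystem.compressCLM_eq_zero_iff hA hU hn hc hξ1 hξ hb hbr hI hcI hdom a.2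
  · push Not at hne
    have hAI : A.toSubmodule ≤ I := by
      refine AFSystem.le_of_upper_le hA hU hI.isClosed fun n => Submodule.span_le.2 ?_
      rintro _ ⟨r, i, j, hij, rfl⟩
      exact hne ⟨n, r, i, j, i, le_rfl, hij⟩
    -- Here `J` is all of `A`, the kernel of the representation on the zero space.
    refine ⟨PUnit.{v + 1}, inferInstance, inferInstance, inferInstance, 0,
      ⟨⟨0, fun a => by simp⟩, fun K L _ _ _ _ => Or.inl ?_⟩, ?_⟩
    · rw [Subsingleton.elim K L]
    · ext a
      rw [TwoSidedIdeal.mem_ker, ← hIJ]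
      exact ⟨fun _ => hAI a.2, fun _ => rfl⟩

theorem theorem2p6 {𝔄 : Type u} [NonUnitalCStarAlgebra 𝔄] (A : NonUnitalSubalgebra ℂ 𝔄)
    (hA : IsStronglyMaximalTAF A) :
    (∀ (H : Type v) [NormedAddCommGroup H] [InnerProductSpace ℂ H] [CompleteSpace H]
      (π : A →ₙₐ[ℂ] (H →L[ℂ] H)), IsBoundedNestRep π →
        IsMeetIrreducible (TwoSidedIdeal.ker π)) ∧
    (∀ J : TwoSidedIdeal A, IsNPrimitive.{v} J ↔ IsMeetIrreducible J) := by
  obtain ⟨M, hM, hU⟩ := hA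
  refine ⟨fun H _ _ _ π hπ => hπ.isMeetIrreducible_ker hM hU, fun J => ⟨?_, fun hJ =>
    hJ.isNPrimitive hM hU⟩⟩
  rintro ⟨H, _, _, _, π, hπ, rfl⟩
  exact hπ.isMeetIrreducible_ker hM hU
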